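/- Let $\beta\in\{1,2,4\}$ and let $\mathbb F_\beta$ be $\mathbb R$, $\mathbb C$ or the real quaternions $\mathbb H$ respectively. Let $N\ge 1$. For a complex number $l$ put $\sigma_l=2\pi^{l/2}/\Gamma(l/2)$ (an entire function of $l$, which for a positive integer $l$ is the surface area of the unit sphere in $\mathbb R^l$). For an $N\times N$ matrix $M$ over $\mathbb F_\beta$ with columns $\mathbf m_1,\dots,\mathbf m_N\in(\mathbb F_\beta)^N$ let $|\det M|$ be the product of the singular values of $M$; for $\beta=4$ this is the square root of the modulus of the determinant of the $2N\times 2N$ complex matrix obtained by replacing each entry $z+wj$ of $M$ ($z,w\in\mathbb C$) by the block $\begin{bmatrix} z&w\\-\overline w&\overline z\end{bmatrix}$. Let $(\mathrm dM)$ be Lebesgue measure in the $\beta N^2$ real components of the entries of $M$ or, for the integral over $\|\mathbf m_i\|=1$, the product of the surface measures on the unit spheres of the $N$ columns. Let $q\in\mathbb C$ and $n=N+q/\beta$. If $\operatorname{Re} q>-\beta$, then the integrals on the left-hand sides below converge absolutely. For every $q$ such that both sides are well defined (that is, the integral on the left converges absolutely, and $\sigma_{\beta(n-i+1)}\neq0$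 for $i=1,\dots,N$, which is automatic for $\operatorname{Re} q>-\beta$), one has $$\Big(\frac{\beta N}{\sigma_{\beta N}}\Big)^N\int_{\|\mathbf m_i\|\le1\ (i=1,\dots,N)}|\det M|^q\,(\mathrm dM)=\prod_{i=1}^N\frac{\sigma_{\beta(N-i+1)}}{\sigma_{\beta(n-i+1)}}\Big(\frac{N\sigma_{\beta n}}{n\,\sigma_{\beta N}}\Big)^N,$$ $$\Big(\frac{1}{\sigma_{\beta N}}\Big)^N\int_{\|\mathbf m_i\|=1\ (i=1,\dots,N)}|\det M|^q\,(\mathrm dM)=\prod_{i=1}^N\frac{\sigma_{\beta(N-i+1)}}{\sigma_{\beta(n-i+1)}}\Big(\frac{\sigma_{\beta n}}{\sigma_{\beta N}}\Big)^N,$$ $$\Big(\frac1\pi\Big)^{\beta N^2/2}\int e^{-\sum_{l=1}^N\|\mathbf m_l\|^2}|\det M|^q\,(\mathrm dM)=\prod_{i=1}^N\frac{\sigma_{\beta(N-i+1)}}{\sigma_{\beta(n-i+1)}}\Big(\frac1\pi\Big)^{\beta N(N-n)/2},$$ the last integral being over all $N\times N$ matrices over $\mathbb F_\beta$. The left-hand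 sides are the moments $\mathbb E|\det M|^q$ of a random matrix $M$ with independent columns that are, respectively, uniform in the unit ball, uniform on the unit sphere, and Gaussian with density $\pi^{-\beta N/2}e^{-\|\mathbf m\|^2}$. -/

import Mathlib

open MeasureTheory

noncomputable section

/-- The three values of the Dyson index, labelled by the number system they stand for. -/
inductive DysonIndex : Type
  | real
  | complex
  | quaternion

namespace DysonIndex

/-- The numerical value `β = 1, 2, 4`: the real dimension of the number system. -/
def val : DysonIndex → ℕ
  | real => 1
  | complex => 2
  | quaternion => 4

/-- The number system `𝔽_β`: the reals, the complex numbers or the real quaternions. -/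
def Scalar : DysonIndex → Type
  | real => ℝ
  | complex => ℂ
  | quaternion => Quaternion ℝ

instance (β : DysonIndex) : NormedAddCommGroup β.Scalar :=
  match β with
  | real => inferInstanceAs (NormedAddCommGroup ℝ)
  | complex => inferInstanceAs (NormedAddCommGroup ℂ)
  | quaternion => inferInstanceAs (NormedAddCommGroup (Quaternion ℝ))

/-- The real inner product for which `1`, resp. `1, i`, resp. `1, i, j, k`, is orthonormal. -/
instance (β : DysonIndex) : InnerProductSpace ℝ β.Scalar :=
  match β with
  | real => inferInstanceAs (InnerProductSpace ℝ ℝ)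
  | complex => inferInstanceAs (InnerProductSpace ℝ ℂ)
  | quaternion => inferInstanceAs (InnerProductSpace ℝ (Quaternion ℝ))

instance (β : DysonIndex) : FiniteDimensional ℝ β.Scalar :=
  match β with
  | real => inferInstanceAs (FiniteDimensional ℝ ℝ)
  | complex => inferInstanceAs (FiniteDimensional ℝ ℂ)
  | quaternion => inferInstanceAs (FiniteDimensional ℝ (Quaternion ℝ))

instance (β : DysonIndex) : SecondCountableTopology β.Scalar :=
  haveI : ProperSpace β.Scalar := FiniteDimensional.proper_real β.Scalar
  inferInstance

instance (β : DysonIndex) : MeasurableSpace β.Scalar := borel _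

instance (β : DysonIndex) : BorelSpace β.Scalar := ⟨rfl⟩

/-- Column vectors of length `N` over `𝔽_β`, with `‖m‖² = ∑ₖ |mₖ|²`; its `volume` is Lebesgue
measure, the product of the `βN` differentials of the real components of the entries. -/
abbrev Column (β : DysonIndex) (N : ℕ) : Type := EuclideanSpace β.Scalar (Fin N)

/-- The matrix whose `j`-th column is `m j`. -/
def ofColumns {β : DysonIndex} {N : ℕ} (m : Fin N → β.Column N) :
    Matrix (Fin N) (Fin N) β.Scalar :=
  Matrix.of fun i j => m j i

end DysonIndex

/-- The representation of the real quaternion `z + w j`, with `z = a + b i` and `w = c + d i`,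
by the `2 × 2` complex matrix with rows `(z, w)` and `(-conj w, conj z)`. -/
def quaternionBlock (h : Quaternion ℝ) : Matrix (Fin 2) (Fin 2) ℂ :=
  let z : ℂ := ⟨h.re, h.imI⟩
  let w : ℂ := ⟨h.imJ, h.imK⟩
  !![z, w; -(starRingEnd ℂ) w, (starRingEnd ℂ) z]

/-- The `2N × 2N` complex matrix representing an `N × N` quaternion matrix. -/
def complexRepresentation {N : ℕ} (M : Matrix (Fin N) (Fin N) (Quaternion ℝ)) :
    Matrix (Fin N × Fin 2) (Fin N × Fin 2) ℂ :=
  Matrix.of fun r s => quaternionBlock (M r.1 s.1) r.2 s.2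

/-- The modulus `|det M|`, the product of the singular values of `M`. The complex representation
of a quaternion matrix has each of its singular values twice, whence the square root. -/
def absDet (β : DysonIndex) {N : ℕ} (M : Matrix (Fin N) (Fin N) β.Scalar) : ℝ :=
  match β, M with
  | .real, M => |Matrix.det (R := ℝ) M|
  | .complex, M => ‖Matrix.det (R := ℂ) M‖
  | .quaternion, M => Real.sqrt ‖(complexRepresentation M).det‖

/-- `σ_l = 2 π^{l/2} / Γ(l/2)`, for a positive integer `l` the area of the unit sphere of `ℝ^l`,
as an entire function of `l`. (Both `Γ` and division by zero have the value `0` at a pole of `Γ`,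
so that `σ_l = 0` exactly for `l = 0, -2, -4, …`, in accordance with `1 / Γ` being entire.) -/
def sphereArea (l : ℂ) : ℂ :=
  2 * (Real.pi : ℂ) ^ (l / 2) / Complex.Gamma (l / 2)

/-- Surface measure on the unit sphere of the space of columns. -/
def surfaceMeasure (β : DysonIndex) (N : ℕ) :
    Measure (Metric.sphere (0 : β.Column N) 1) :=
  (volume : Measure (β.Column N)).toSphere

end

/-! Everything reduces to the Gaussian moment, which is computed one column at a time. Fix the first
column `v`. A Householder reflection `H` sends `v` to a multiple of the first basis vector and has
`|det H| = 1`, so `|det M|` is `‖v‖` times `|det|` of a minor of `H * M`. The other columns are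
Gaussian and independent of `v`; their law is invariant under `H`, and deleting an entry leaves a
Gaussian column one entry shorter. Hence `|det M|` has the law of a product of independent norms of
Gaussian vectors in dimensions `β, 2β, …, Nβ` (`absDetLaw_succ`). In dimension `d` the norm has
`q`-th moment `π^{q/2} σ_d / σ_{d+q}` (`integral_cpow_norm_gaussMeasure`), and the product of these
is the third formula.

Since `|det|` is homogeneous of degree one in each column, polar coordinates turn the integral of
`|det M|^q ∏ φ(‖m_i‖)` into the spherical integral times the `N`-th power of the Mellin transform of
`φ` at `βN + q` (`integral_weight_mul_detPow`). A Gaussian `φ` then yields the spherical integral,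
and the indicator of `t ≤ 1` yields the ball.

The identities are claimed wherever the integrals converge, so the exact range is needed. The same
factorizations hold for integrals of absolute values in `[0, ∞]`, where finiteness can be read off
factor by factor once no factor vanishes. The Gaussian and ball integrals converge exactly for `Re q
> -β`. On the sphere this is also the range if `N ≥ 2`, by boundedness of `|det|`; if `N = 1`, then
`|det| = 1` there and every `q` is allowed. -/

open scoped ENNReal

noncomputable section

/-! ### Householder reflections over a division ring with involution -/

/-- A Householder reflection carries any vector over a real, complex or quaternionic scalar
system to a multiple of the first basis vector. -/
theorem exists_unitary_mulVec_eq_single {K : Type*} [NormedDivisionRing K] [NormedAlgebra ℝ K]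
    [StarRing K] (hK : ∀ a : K, star a * a = algebraMap ℝ K (‖a‖ ^ 2)) {n : ℕ}
    (v : Fin (n + 1) → K) :
    ∃ H : Matrix (Fin (n + 1)) (Fin (n + 1)) K, H * H = 1 ∧
      (∃ c : K, ‖c‖ ^ 2 = ∑ i, ‖v i‖ ^ 2 ∧ H.mulVec v = Pi.single 0 c) ∧
      ∀ x : Fin (n + 1) → K, ∑ i, ‖H.mulVec x i‖ ^ 2 = ∑ i, ‖x i‖ ^ 2 := by
  have hdot : ∀ x : Fin (n + 1) → K,
      star x ⬝ᵥ x = algebraMap ℝ K (∑ i, ‖x i‖ ^ 2) := by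
    intro x
    simp [dotProduct, hK]
  have hcomm : ∀ (r : ℝ) (a : K), algebraMap ℝ K r * a = a * algebraMap ℝ K r :=
    fun r a => Algebra.commutes r a
  have hinj : Function.Injective (algebraMap ℝ K) := (algebraMap ℝ K).injective
  have hstar : ∀ r : ℝ, star (algebraMap ℝ K r) = algebraMap ℝ K r := by
    -- A nonnegative real is `star a * a` with `a` its square root, hence self-adjoint.
    have h0 : ∀ r : ℝ, 0 ≤ r → star (algebraMap ℝ K r) = algebraMap ℝ K r := by
      intro r hr
      have h := hK (algebraMap ℝ K (√r))
      rw [norm_algebraMap', Real.norm_of_nonneg (Real.sqrt_nonneg r), Real.sq_sqrt hr] at h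
      rw [← h]; simp
    intro r
    rcases le_total 0 r with hr | hr
    · exact h0 r hr
    · have := h0 (-r) (by linarith)
      simpa using this
  -- the phase
  obtain ⟨u, hu, hu0⟩ : ∃ u : K, ‖u‖ = 1 ∧ v 0 = algebraMap ℝ K ‖v 0‖ * u := by
    by_cases h : v 0 = 0
    · exact ⟨1, by simp, by simp [h]⟩
    · have h' : ‖v 0‖ ≠ 0 := by simpa using h
      refine ⟨algebraMap ℝ K ‖v 0‖⁻¹ * v 0, ?_, ?_⟩
      · rw [norm_mul, norm_algebraMap']; simp [h]
      · rw [← mul_assoc, ← map_mul, mul_inv_cancel₀ h']; simp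
  set ρ : ℝ := √(∑ i, ‖v i‖ ^ 2) with hρ
  have hρ2 : ρ ^ 2 = ∑ i, ‖v i‖ ^ 2 := Real.sq_sqrt (Finset.sum_nonneg fun i _ => by positivity)
  -- Giving `c` the phase of `v 0` makes `star c * v 0` real, hence central. Then `star w ⬝ᵥ v` is
  -- real and is half of `star w ⬝ᵥ w`, which is what lets the reflection along `w` work without
  -- commutativity.
  set c : K := algebraMap ℝ K ρ * u with hc
  have hcn : ‖c‖ ^ 2 = ρ ^ 2 := by
    rw [hc, norm_mul, norm_algebraMap', hu]; simp
  set w : Fin (n + 1) → K := v - Pi.single 0 c with hw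
  have huu : star u * u = 1 := by rw [hK, hu]; simp
  have hcv : star c * v 0 = algebraMap ℝ K (ρ * ‖v 0‖) := by
    rw [hu0, hc, star_mul, hstar, mul_assoc, ← mul_assoc (algebraMap ℝ K ρ), ← map_mul, 
      hcomm, ← mul_assoc, huu, one_mul, norm_mul, norm_algebraMap', hu]
    simp
  have hvc : star (v 0) * c = algebraMap ℝ K (ρ * ‖v 0‖) := by
    have := congrArg star hcv
    rwa [star_mul, star_star, hstar] at this
  have hsc : ∀ x : Fin (n + 1) → K, star (Pi.single 0 c : Fin (n + 1) → K) ⬝ᵥ x = star c * x 0 := by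
    intro x
    rw [← Pi.single_star, single_dotProduct]
  have hwv : star w ⬝ᵥ v = algebraMap ℝ K (ρ ^ 2 - ρ * ‖v 0‖) := by
    rw [hw, star_sub, sub_dotProduct, hdot, hsc, hcv, map_sub, hρ2]
  have hww : star w ⬝ᵥ w = algebraMap ℝ K (2 * (ρ ^ 2 - ρ * ‖v 0‖)) := by
    have h1 : star w ⬝ᵥ (Pi.single 0 c : Fin (n + 1) → K)
        = algebraMap ℝ K (ρ * ‖v 0‖ - ρ ^ 2) := by
      rw [dotProduct_single, hw]
      simp only [Pi.star_apply, Pi.sub_apply, Pi.single_eq_same, star_sub, sub_mul, hvc, hK, hcn,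
        map_sub]
    conv_lhs => rw [show w = v - Pi.single 0 c from hw]
    rw [← hw, dotProduct_sub, hwv, h1, ← map_sub]
    congr 1; ring
  set t : ℝ := ρ ^ 2 - ρ * ‖v 0‖ with ht
  have ht' : ∑ i, ‖w i‖ ^ 2 = 2 * t := hinj (by rw [← hdot, hww])
  set P : Matrix (Fin (n + 1)) (Fin (n + 1)) K := Matrix.vecMulVec w (star w) with hP
  have hPmul : ∀ x, P.mulVec x = fun i => w i * (star w ⬝ᵥ x) := by
    intro x; ext i
    simp [hP, Matrix.mulVec, Matrix.vecMulVec, dotProduct, Finset.mul_sum, mul_assoc]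
  have hPP : P * P = (2 * t) • P := by
    ext i j
    rw [Matrix.mul_apply]
    simp only [hP, Matrix.vecMulVec_apply, Matrix.smul_apply]
    rw [Algebra.smul_def, ← hww, ← mul_assoc, hww, hcomm, ← hww, dotProduct, Finset.mul_sum,
      Finset.sum_mul]
    exact Finset.sum_congr rfl fun k _ => by simp only [Pi.star_apply, mul_assoc]
  -- For `t = 0` one has `w = 0`: `v` is already a multiple of the basis vector, and the convention
  -- `0⁻¹ = 0` makes the reflection below the identity.
  have hscal : t⁻¹ * (2 * t) * t⁻¹ = 2 * t⁻¹ := by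
    by_cases h : t = 0
    · simp [h]
    · field_simp
  refine ⟨1 - t⁻¹ • P, ?_, ⟨c, by rw [hcn, hρ2], ?_⟩, ?_⟩
  · rw [sub_mul, mul_sub, mul_sub, smul_mul_smul_comm, hPP, smul_smul, one_mul, mul_one, one_mul]
    rw [show t⁻¹ * t⁻¹ * (2 * t) = 2 * t⁻¹ by rw [← hscal]; ring, mul_smul, two_smul]
    abel
  · ext i
    rw [Matrix.sub_mulVec, Matrix.one_mulVec, Matrix.smul_mulVec, hPmul, hwv]
    simp only [Pi.sub_apply, Pi.smul_apply]
    rw [← hcomm, ← Algebra.smul_def, smul_smul]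
    by_cases h : t = 0
    · have hw0 : w i = 0 := by
        have h1 : ∑ i, ‖w i‖ ^ 2 = 0 := by rw [ht', h, mul_zero]
        have h2 := (Finset.sum_eq_zero_iff_of_nonneg fun i _ => by positivity).1 h1 i
          (Finset.mem_univ i)
        simpa using h2
      rw [hw0, smul_zero, sub_zero]
      exact sub_eq_zero.1 hw0
    · rw [inv_mul_cancel₀ h, one_smul, hw]
      simp
  · intro x
    apply hinj
    rw [← hdot, ← hdot, Matrix.sub_mulVec, Matrix.one_mulVec, Matrix.smul_mulVec, hPmul]
    set a : K := star w ⬝ᵥ x with ha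
    have hxw : star x ⬝ᵥ w = star a := by
      rw [ha, dotProduct, dotProduct, star_sum]
      exact Finset.sum_congr rfl fun i _ => by simp
    have hy : (t⁻¹ • fun i => w i * a) = fun i => w i * (algebraMap ℝ K t⁻¹ * a) := by
      ext i
      simp only [Pi.smul_apply, Algebra.smul_def]
      rw [← mul_assoc, hcomm, mul_assoc]
    have hr : ∀ (y : Fin (n + 1) → K) (b : K), y ⬝ᵥ (fun i => w i * b) = (y ⬝ᵥ w) * b := by
      intro y b
      simp [dotProduct, Finset.sum_mul, mul_assoc]
    have hl : ∀ (y : Fin (n + 1) → K) (b : K),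
        star (fun i => w i * b) ⬝ᵥ y = star b * (star w ⬝ᵥ y) := by
      intro y b
      simp [dotProduct, Finset.mul_sum, mul_assoc]
    rw [hy, star_sub, sub_dotProduct, dotProduct_sub, dotProduct_sub, hr, hr, hxw, hl, hl, hww,
      ← ha, star_mul, hstar]
    have e1 : star a * algebraMap ℝ K t⁻¹ * (algebraMap ℝ K (2 * t) * (algebraMap ℝ K t⁻¹ * a))
        = algebraMap ℝ K (2 * t⁻¹) * (star a * a) := by
      rw [← hcomm]
      simp only [← Algebra.smul_def, smul_mul_assoc, mul_smul_comm, smul_smul]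
      rw [← hscal]
    have e2 : star a * (algebraMap ℝ K t⁻¹ * a) = algebraMap ℝ K t⁻¹ * (star a * a) := by
      rw [← mul_assoc, ← hcomm, mul_assoc]
    have e3 : star a * algebraMap ℝ K t⁻¹ * a = algebraMap ℝ K t⁻¹ * (star a * a) := by
      rw [← hcomm, mul_assoc]
    rw [mul_assoc (star a * algebraMap ℝ K t⁻¹), e1, e2, e3, map_mul, map_ofNat, two_mul, add_mul]
    abel

/-! ### Elimination of a column for an abstract modulus of the determinant -/

/-- A square matrix functional behaving like the modulus of the determinant. -/
structure IsAbsDet {K : Type*} [NormedRing K]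
    (D : ∀ n : ℕ, Matrix (Fin n) (Fin n) K → ℝ) : Prop where
  nonneg : ∀ n M, 0 ≤ D n M
  one : ∀ n, D n 1 = 1
  mul : ∀ n A B, D n (A * B) = D n A * D n B
  of_column_zero : ∀ n (M : Matrix (Fin (n + 1)) (Fin (n + 1)) K) (c : K),
    (∀ i, M i 0 = (Pi.single 0 c : Fin (n + 1) → K) i) →
      D (n + 1) M = ‖c‖ * D n (M.submatrix Fin.succ Fin.succ)

/-- For a fixed first column there is an involutive isometry of the space of columns that reduces
the modulus of the determinant to that of a minor. -/
theorem IsAbsDet.exists_involution {K : Type*} [NormedDivisionRing K] [NormedAlgebra ℝ K]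
    [StarRing K] (hK : ∀ a : K, star a * a = algebraMap ℝ K (‖a‖ ^ 2))
    {D : ∀ n : ℕ, Matrix (Fin n) (Fin n) K → ℝ} (hD : IsAbsDet D) {n : ℕ}
    (v : Fin (n + 1) → K) :
    ∃ T : (Fin (n + 1) → K) →ₗ[ℝ] (Fin (n + 1) → K), (∀ x, T (T x) = x) ∧
      (∀ x, ∑ i, ‖T x i‖ ^ 2 = ∑ i, ‖x i‖ ^ 2) ∧
      ∀ m : Fin n → (Fin (n + 1) → K),
        D (n + 1) (Matrix.of fun i j => (Fin.cons v m : Fin (n + 1) → Fin (n + 1) → K) j i) =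
          √(∑ i, ‖v i‖ ^ 2) * D n (Matrix.of fun i j => T (m j) i.succ) := by
  obtain ⟨H, hHH, ⟨c, hc, hHv⟩, hnorm⟩ := exists_unitary_mulVec_eq_single hK v
  have hDH : D (n + 1) H = 1 := by
    have h := hD.mul _ H H
    rw [hHH, hD.one] at h
    nlinarith [hD.nonneg _ H]
  refine ⟨{ toFun := H.mulVec
            map_add' := Matrix.mulVec_add H
            map_smul' := fun r x => Matrix.mulVec_smul H r x }, fun x => ?_, hnorm, fun m => ?_⟩
  · simp [Matrix.mulVec_mulVec, hHH]
  · rw [← hc, Real.sqrt_sq (norm_nonneg c)]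
    set M : Matrix (Fin (n + 1)) (Fin (n + 1)) K :=
      Matrix.of fun i j => (Fin.cons v m : Fin (n + 1) → Fin (n + 1) → K) j i
    have hM : D (n + 1) M = D (n + 1) (H * M) := by rw [hD.mul, hDH, one_mul]
    rw [hM, hD.of_column_zero n (H * M) c]
    · rfl
    · intro i
      rw [← hHv]
      rfl

/-! ### The modulus of the determinant in the three cases -/

/-- Quaternions as `2 × 2` complex matrices. -/
def quaternionBlockHom : Quaternion ℝ →+* Matrix (Fin 2) (Fin 2) ℂ where
  toFun := quaternionBlock
  map_one' := by
    ext i j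
    fin_cases i <;> fin_cases j <;>
      simp [quaternionBlock, Complex.ext_iff, Quaternion.re_one, Quaternion.imI_one,
        Quaternion.imJ_one, Quaternion.imK_one]
  map_zero' := by
    ext i j
    fin_cases i <;> fin_cases j <;>
      simp [quaternionBlock, Complex.ext_iff, Quaternion.re_zero, Quaternion.imI_zero,
        Quaternion.imJ_zero, Quaternion.imK_zero]
  map_add' x y := by
    ext i j
    fin_cases i <;> fin_cases j <;> simp [quaternionBlock, Complex.ext_iff] <;> ring
  map_mul' x y := by
    ext i j
    fin_cases i <;> fin_cases j <;>
      simp [quaternionBlock, Complex.ext_iff, Matrix.mul_apply, Fin.sum_univ_two] <;>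
      constructor <;> ring

theorem complexRepresentation_eq {N : ℕ} (M : Matrix (Fin N) (Fin N) (Quaternion ℝ)) :
    complexRepresentation M =
      Matrix.compRingEquiv (Fin N) (Fin 2) ℂ (quaternionBlockHom.mapMatrix M) := rfl

theorem complexRepresentation_mul {N : ℕ} (A B : Matrix (Fin N) (Fin N) (Quaternion ℝ)) :
    complexRepresentation (A * B) = complexRepresentation A * complexRepresentation B := by
  simp only [complexRepresentation_eq, map_mul]

theorem complexRepresentation_one {N : ℕ} :
    complexRepresentation (1 : Matrix (Fin N) (Fin N) (Quaternion ℝ)) = 1 := by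
  simp only [complexRepresentation_eq, map_one]

theorem det_quaternionBlock (h : Quaternion ℝ) : (quaternionBlock h).det = (‖h‖ : ℂ) ^ 2 := by
  rw [← Complex.ofReal_pow, sq, ← Quaternion.normSq_eq_norm_mul_self, Quaternion.normSq_def']
  rw [quaternionBlock, Matrix.det_fin_two]
  apply Complex.ext <;> simp [-Complex.ofReal_add, -Complex.ofReal_pow] <;> ring

/-- The complex matrix is block upper triangular, with the block of `c`, of determinant `‖c‖²`, in
the corner. This replaces expansion along a column, which has no direct quaternionic version. -/
theorem det_complexRepresentation_of_column_zero {N : ℕ}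
    (M : Matrix (Fin (N + 1)) (Fin (N + 1)) (Quaternion ℝ)) (c : Quaternion ℝ)
    (h : ∀ i, M i 0 = (Pi.single 0 c : Fin (N + 1) → Quaternion ℝ) i) :
    (complexRepresentation M).det =
      (‖c‖ : ℂ) ^ 2 * (complexRepresentation (M.submatrix Fin.succ Fin.succ)).det := by
  let e : Fin 2 ⊕ (Fin N × Fin 2) ≃ Fin (N + 1) × Fin 2 :=
    { toFun := Sum.elim (fun t => (0, t)) (fun p => (p.1.succ, p.2))
      invFun := fun p => Fin.cases (motive := fun _ => Fin 2 ⊕ (Fin N × Fin 2)) (Sum.inl p.2)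
        (fun i => Sum.inr (i, p.2)) p.1
      left_inv := by rintro (t | ⟨i, t⟩) <;> rfl
      right_inv := by
        rintro ⟨i, t⟩
        refine Fin.cases ?_ (fun i => ?_) i <;> rfl }
  rw [← Matrix.det_submatrix_equiv_self e, ← det_quaternionBlock]
  rw [← Matrix.fromBlocks_toBlocks ((complexRepresentation M).submatrix e e)]
  have h21 : ((complexRepresentation M).submatrix e e).toBlocks₂₁ = 0 := by
    ext ⟨i, s⟩ t
    have hi : M i.succ 0 = 0 := by rw [h]; simp
    change quaternionBlock (M i.succ 0) s t = 0
    rw [hi]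
    exact congrFun (congrFun quaternionBlockHom.map_zero s) t
  rw [h21, Matrix.det_fromBlocks_zero₂₁]
  congr 2
  ext s t
  have h0 : M 0 0 = c := by rw [h]; simp
  change quaternionBlock (M 0 0) s t = _
  rw [h0]

theorem isAbsDet_real :
    IsAbsDet (K := ℝ) fun n M => absDet .real (N := n) M where
  nonneg _ _ := abs_nonneg _
  one n := by
    change |Matrix.det (1 : Matrix (Fin n) (Fin n) ℝ)| = 1
    simp
  mul n A B := by
    change |Matrix.det (A * B)| = |Matrix.det A| * |Matrix.det B|
    rw [Matrix.det_mul, abs_mul]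
  of_column_zero n M c h := by
    change |Matrix.det M| = ‖c‖ * |Matrix.det (M.submatrix Fin.succ Fin.succ)|
    rw [Matrix.det_succ_column_zero, Fin.sum_univ_succ]
    simp [h, abs_mul]

theorem isAbsDet_complex :
    IsAbsDet (K := ℂ) fun n M => absDet .complex (N := n) M where
  nonneg _ _ := norm_nonneg _
  one n := by
    change ‖Matrix.det (1 : Matrix (Fin n) (Fin n) ℂ)‖ = 1
    simp
  mul n A B := by
    change ‖Matrix.det (A * B)‖ = ‖Matrix.det A‖ * ‖Matrix.det B‖
    rw [Matrix.det_mul, norm_mul]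
  of_column_zero n M c h := by
    change ‖Matrix.det M‖ = ‖c‖ * ‖Matrix.det (M.submatrix Fin.succ Fin.succ)‖
    rw [Matrix.det_succ_column_zero, Fin.sum_univ_succ]
    simp [h]

theorem isAbsDet_quaternion :
    IsAbsDet (K := Quaternion ℝ) fun n M => absDet .quaternion (N := n) M where
  nonneg _ _ := Real.sqrt_nonneg _
  one n := by
    change √‖(complexRepresentation (1 : Matrix (Fin n) (Fin n) (Quaternion ℝ))).det‖ = 1
    simp [complexRepresentation_one]
  mul n A B := by
    change √‖(complexRepresentation (A * B)).det‖ =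
      √‖(complexRepresentation A).det‖ * √‖(complexRepresentation B).det‖
    rw [complexRepresentation_mul, Matrix.det_mul, norm_mul, Real.sqrt_mul (norm_nonneg _)]
  of_column_zero n M c h := by
    change √‖(complexRepresentation M).det‖ =
      ‖c‖ * √‖(complexRepresentation (M.submatrix Fin.succ Fin.succ)).det‖
    rw [det_complexRepresentation_of_column_zero M c h, norm_mul, Real.sqrt_mul (norm_nonneg _)]
    simp

theorem quaternionBlock_smul (r : ℝ) (h : Quaternion ℝ) (i j : Fin 2) :
    quaternionBlock (r • h) i j = r * quaternionBlock h i j := by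
  fin_cases i <;> fin_cases j <;> simp [quaternionBlock, Complex.ext_iff]

/-! ### Homogeneity, continuity and column elimination for `absDet` -/

namespace DysonIndex

theorem absDet_nonneg {β : DysonIndex} {N : ℕ} (M : Matrix (Fin N) (Fin N) β.Scalar) :
    0 ≤ absDet β M := by
  cases β
  · exact abs_nonneg _
  · exact norm_nonneg _
  · exact Real.sqrt_nonneg _

theorem absDet_ofColumns_zero {β : DysonIndex} (m : Fin 0 → β.Column 0) :
    absDet β (ofColumns m) = 1 := by
  cases β
  · change |Matrix.det (R := ℝ) _| = 1
    exact (congrArg abs Matrix.det_isEmpty).trans abs_one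
  · change ‖Matrix.det (R := ℂ) _‖ = 1
    exact (congrArg norm Matrix.det_isEmpty).trans norm_one
  · change √‖Matrix.det (R := ℂ) _‖ = 1
    rw [Matrix.det_isEmpty, norm_one, Real.sqrt_one]

/-- Multilinearity of the determinant. A quaternionic column occupies two complex columns, so each
scalar enters squared and the square root in `absDet` undoes this. -/
theorem absDet_ofColumns_smul {β : DysonIndex} {N : ℕ} (r : Fin N → ℝ) (m : Fin N → β.Column N) :
    absDet β (ofColumns fun i => r i • m i) = (∏ i, |r i|) * absDet β (ofColumns m) := by
  cases β
  · refine (congrArg abs (Matrix.det_mul_row r (ofColumns m : Matrix _ _ ℝ))).trans ?_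
    rw [abs_mul, Finset.abs_prod]
    rfl
  · refine (congrArg norm (Matrix.det_mul_row (fun i => (r i : ℂ))
      (ofColumns m : Matrix _ _ ℂ))).trans ?_
    rw [norm_mul, norm_prod]
    simp only [Complex.norm_real, Real.norm_eq_abs]
    rfl
  · have h : complexRepresentation (ofColumns fun i => r i • m i) =
        Matrix.of fun i j : Fin N × Fin 2 => (r j.1 : ℂ) * complexRepresentation (ofColumns m) i j := by
      ext i j
      exact quaternionBlock_smul _ _ _ _
    change √‖(complexRepresentation (ofColumns fun i => r i • m i)).det‖ =
      _ * √‖(complexRepresentation (ofColumns m)).det‖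
    rw [h, Matrix.det_mul_row (fun j : Fin N × Fin 2 => (r j.1 : ℂ)), norm_mul,
      Real.sqrt_mul (norm_nonneg _), Fintype.prod_prod_type]
    congr 1
    simp only [Fin.prod_univ_two, norm_prod, norm_mul, Complex.norm_real, Real.norm_eq_abs,
      Finset.prod_mul_distrib]
    rw [Real.sqrt_mul_self (Finset.prod_nonneg fun i _ => abs_nonneg _)]

theorem continuous_absDet {β : DysonIndex} {N : ℕ} :
    Continuous fun m : Fin N → β.Column N => absDet β (ofColumns m) := by
  have hentry : ∀ i j : Fin N, Continuous fun m : Fin N → β.Column N => m j i := by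
    intro i j
    fun_prop
  cases β
  · exact continuous_abs.comp (Continuous.matrix_det (R := ℝ)
      (A := fun m : Fin N → DysonIndex.real.Column N => (ofColumns m : Matrix _ _ ℝ))
      (continuous_matrix hentry))
  · exact continuous_norm.comp (Continuous.matrix_det (R := ℂ)
      (A := fun m : Fin N → DysonIndex.complex.Column N => (ofColumns m : Matrix _ _ ℂ))
      (continuous_matrix hentry))
  · refine Real.continuous_sqrt.comp (continuous_norm.comp (Continuous.matrix_det (R := ℂ)
      (A := fun m : Fin N → DysonIndex.quaternion.Column N => complexRepresentation (ofColumns m))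
      (continuous_matrix fun i j => ?_)))
    have hq : Continuous fun h : Quaternion ℝ => quaternionBlock h i.2 j.2 := by
      let L : Quaternion ℝ →ₗ[ℝ] ℂ :=
        { toFun := fun h => quaternionBlock h i.2 j.2
          map_add' := fun x y => congrFun (congrFun (quaternionBlockHom.map_add x y) i.2) j.2
          map_smul' := fun r x => by rw [quaternionBlock_smul]; simp }
      exact L.continuous_of_finiteDimensional
    exact hq.comp (hentry i.1 j.1)

/-- The column without its first entry. -/
def tail {β : DysonIndex} {N : ℕ} (m : β.Column (N + 1)) : β.Column N :=
  WithLp.toLp 2 fun i => m i.succ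

theorem exists_linearIsometryEquiv_aux {K : Type*} [NormedAddCommGroup K] [InnerProductSpace ℝ K]
    {n : ℕ} (T : (Fin n → K) →ₗ[ℝ] (Fin n → K)) (hT : ∀ x, T (T x) = x)
    (hnorm : ∀ x, ∑ i, ‖T x i‖ ^ 2 = ∑ i, ‖x i‖ ^ 2) :
    ∃ U : EuclideanSpace K (Fin n) ≃ₗᵢ[ℝ] EuclideanSpace K (Fin n),
      ∀ x, WithLp.ofLp (U x) = T (WithLp.ofLp x) :=
  ⟨{ toFun := fun x => WithLp.toLp 2 (T x.ofLp)
     invFun := fun x => WithLp.toLp 2 (T x.ofLp)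
     map_add' := fun x y => by simp
     map_smul' := fun r x => by simp
     left_inv := fun x => by simp [hT]
     right_inv := fun x => by simp [hT]
     norm_map' := fun x => by
      change ‖WithLp.toLp 2 (T x.ofLp)‖ = ‖x‖
      rw [PiLp.norm_eq_of_L2, PiLp.norm_eq_of_L2]
      exact congrArg Real.sqrt (hnorm x.ofLp) }, fun _ => rfl⟩

/-- Elimination of the first column of `|det|` by an isometry of the space of columns. -/
theorem exists_linearIsometryEquiv_absDet_cons {β : DysonIndex} {N : ℕ} (v : β.Column (N + 1)) :
    ∃ U : β.Column (N + 1) ≃ₗᵢ[ℝ] β.Column (N + 1), ∀ m : Fin N → β.Column (N + 1),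
      absDet β (ofColumns (Fin.cons v m : Fin (N + 1) → β.Column (N + 1))) =
        ‖v‖ * absDet β (ofColumns fun i => tail (U (m i))) := by
  have key : ∃ T : (Fin (N + 1) → β.Scalar) →ₗ[ℝ] (Fin (N + 1) → β.Scalar), (∀ x, T (T x) = x) ∧
      (∀ x, ∑ i, ‖T x i‖ ^ 2 = ∑ i, ‖x i‖ ^ 2) ∧
      ∀ m : Fin N → (Fin (N + 1) → β.Scalar),
        absDet β (Matrix.of fun i j =>
          (Fin.cons v.ofLp m : Fin (N + 1) → Fin (N + 1) → β.Scalar) j i) =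
          √(∑ i, ‖v.ofLp i‖ ^ 2) * absDet β (Matrix.of fun i j => T (m j) i.succ) := by
    cases β
    · exact isAbsDet_real.exists_involution (fun a => by simp [sq]) v.ofLp
    · exact isAbsDet_complex.exists_involution (fun a => by
        simp [Complex.conj_mul']) v.ofLp
    · exact isAbsDet_quaternion.exists_involution (fun a => by
        rw [Quaternion.star_mul_self, sq, ← Quaternion.normSq_eq_norm_mul_self]; rfl) v.ofLp
  obtain ⟨T, hT, hnorm, hdet⟩ := key
  obtain ⟨U, hU⟩ := exists_linearIsometryEquiv_aux T hT hnorm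
  refine ⟨U, fun m => ?_⟩
  have h := hdet fun i => (m i).ofLp
  rw [PiLp.norm_eq_of_L2]
  convert h using 2
  · ext i j
    refine Fin.cases ?_ (fun j => ?_) j <;> simp [ofColumns]
  · congr 1
    ext i j
    simp [ofColumns, tail, hU]

end DysonIndex

/-! ### Finite products of measures -/

/-- Tonelli's theorem for a product of functions of separate variables. -/
theorem lintegral_fin_prod_eq_prod {n : ℕ} {E : Fin n → Type*} [∀ i, MeasurableSpace (E i)]
    (μ : ∀ i, Measure (E i)) [∀ i, SigmaFinite (μ i)] {f : ∀ i, E i → ℝ≥0∞}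
    (hf : ∀ i, Measurable (f i)) :
    ∫⁻ x, ∏ i, f i (x i) ∂(Measure.pi μ) = ∏ i, ∫⁻ x, f i x ∂(μ i) := by
  induction n with
  | zero => simp [lintegral_const]
  | succ n ih =>
    have h := (measurePreserving_piFinSuccAbove μ 0).symm
    rw [← h.lintegral_comp_emb (MeasurableEquiv.measurableEmbedding _), Fin.prod_univ_succ,
      ← ih (fun i => μ i.succ) (fun i => hf i.succ),
      ← lintegral_prod_mul (hf 0).aemeasurable
        (Finset.measurable_prod _ fun i _ => (hf i.succ).comp (measurable_pi_apply i)).aemeasurable]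
    refine lintegral_congr fun x => ?_
    rw [Fin.prod_univ_succ]
    rfl

theorem lintegral_pi_succ {n : ℕ} {X : Type*} [MeasurableSpace X] (μ : Measure X) [SigmaFinite μ]
    {F : (Fin (n + 1) → X) → ℝ≥0∞} (hF : Measurable F) :
    ∫⁻ m, F m ∂(Measure.pi fun _ => μ) =
      ∫⁻ v, ∫⁻ m, F (Fin.cons v m) ∂(Measure.pi fun _ => μ) ∂μ := by
  have h := (measurePreserving_piFinSuccAbove (fun _ : Fin (n + 1) => μ) 0).symm
  rw [← h.lintegral_comp_emb (MeasurableEquiv.measurableEmbedding _),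
    lintegral_prod (fun p => F ((MeasurableEquiv.piFinSuccAbove (fun _ => X) 0).symm p))
      (hF.comp (MeasurableEquiv.measurable _)).aemeasurable]
  refine lintegral_congr fun v => lintegral_congr fun m => ?_
  congr 1
  ext i
  refine Fin.cases ?_ (fun i => ?_) i <;> rfl

theorem pi_withDensity_fin {n : ℕ} {X : Type*} [MeasurableSpace X] (μ : Measure X) [SigmaFinite μ]
    {f : X → ℝ≥0∞} (hf : Measurable f) [SigmaFinite (μ.withDensity f)] :
    Measure.pi (fun _ : Fin n => μ.withDensity f) =
      (Measure.pi fun _ => μ).withDensity fun x => ∏ i, f (x i) := by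
  refine Measure.pi_eq fun s hs => ?_
  rw [withDensity_apply _ (MeasurableSet.univ_pi hs),
    ← lintegral_indicator (MeasurableSet.univ_pi hs)]
  have h : ∀ x : Fin n → X, (Set.univ.pi s).indicator (fun x => ∏ i, f (x i)) x =
      ∏ i, (s i).indicator f (x i) := by
    intro x
    by_cases hx : x ∈ Set.univ.pi s
    · rw [Set.indicator_of_mem hx]
      exact Finset.prod_congr rfl fun i _ => (Set.indicator_of_mem (hx i (Set.mem_univ i)) _).symm
    · rw [Set.indicator_of_notMem hx]
      simp only [Set.mem_pi, Set.mem_univ, true_imp_iff, not_forall] at hx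
      obtain ⟨i, hi⟩ := hx
      exact (Finset.prod_eq_zero (Finset.mem_univ i) (Set.indicator_of_notMem hi _)).symm
  simp_rw [h]
  rw [lintegral_fin_prod_eq_prod (fun _ => μ) fun i => hf.indicator (hs i)]
  exact Finset.prod_congr rfl fun i _ => by
    rw [lintegral_indicator (hs i), withDensity_apply _ (hs i)]

/-! ### Gaussian measures, their isometry invariance and their product structure -/

section Gaussian

variable (E : Type*) [NormedAddCommGroup E] [InnerProductSpace ℝ E] [MeasurableSpace E]
  [BorelSpace E]

/-- The density `π^{-d/2} e^{-‖x‖²}` of the Gaussian measure on a `d`-dimensional space. -/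
def gaussDensity (x : E) : ℝ≥0∞ :=
  ENNReal.ofReal (Real.pi ^ (-(Module.finrank ℝ E / 2 : ℝ)) * Real.exp (-‖x‖ ^ 2))

theorem measurable_gaussDensity : Measurable (gaussDensity E) := by
  unfold gaussDensity
  fun_prop

variable [FiniteDimensional ℝ E]

/-- The Gaussian probability measure with density `π^{-d/2} e^{-‖x‖²}`. -/
def gaussMeasure : Measure E := volume.withDensity (gaussDensity E)

theorem integral_exp_neg_sq_norm :
    ∫ x : E, Real.exp (-‖x‖ ^ 2) = Real.pi ^ (Module.finrank ℝ E / 2 : ℝ) := by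
  have h := GaussianFourier.integral_rexp_neg_mul_sq_norm (V := E) one_pos
  simpa using h

theorem integrable_exp_neg_sq_norm : Integrable fun x : E => Real.exp (-‖x‖ ^ 2) :=
  Integrable.of_integral_ne_zero (by
    rw [integral_exp_neg_sq_norm]
    exact (Real.rpow_pos_of_pos Real.pi_pos _).ne')

instance : IsProbabilityMeasure (gaussMeasure E) := by
  constructor
  rw [gaussMeasure, withDensity_apply _ MeasurableSet.univ, setLIntegral_univ]
  unfold gaussDensity
  rw [← ofReal_integral_eq_lintegral_ofReal ((integrable_exp_neg_sq_norm E).const_mul _)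
    (Filter.Eventually.of_forall fun x => by positivity), integral_const_mul,
    integral_exp_neg_sq_norm, ← Real.rpow_add Real.pi_pos]
  simp

variable {E}
variable {F : Type*} [NormedAddCommGroup F] [InnerProductSpace ℝ F] [FiniteDimensional ℝ F]
  [MeasurableSpace F] [BorelSpace F]

theorem measurePreserving_gaussMeasure_of_volume {f : E → F} (hf : MeasurePreserving f)
    (h : ∀ x, gaussDensity F (f x) = gaussDensity E x) :
    MeasurePreserving f (gaussMeasure E) (gaussMeasure F) := by
  refine ⟨hf.measurable, ?_⟩
  ext s hs
  rw [Measure.map_apply hf.measurable hs, gaussMeasure, gaussMeasure,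
    withDensity_apply _ (hf.measurable hs), withDensity_apply _ hs,
    ← hf.setLIntegral_comp_preimage hs (measurable_gaussDensity F)]
  simp_rw [h]

theorem LinearIsometryEquiv.measurePreserving_gaussMeasure (e : E ≃ₗᵢ[ℝ] F) :
    MeasurePreserving e (gaussMeasure E) (gaussMeasure F) :=
  measurePreserving_gaussMeasure_of_volume e.measurePreserving fun x => by
    simp [gaussDensity, e.toLinearEquiv.finrank_eq]

/-- The density factors because the squared norm of a pair is the sum of the squared norms. It
follows that the entries of a Gaussian column below the first again form a Gaussian column. -/
theorem measurePreserving_ofLp_gaussMeasure :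
    MeasurePreserving (WithLp.ofLp : WithLp 2 (E × F) → E × F) (gaussMeasure (WithLp 2 (E × F)))
      ((gaussMeasure E).prod (gaussMeasure F)) := by
  have hf := WithLp.volume_preserving_ofLp E F
  refine ⟨hf.measurable, ?_⟩
  rw [gaussMeasure, gaussMeasure, gaussMeasure,
    prod_withDensity (measurable_gaussDensity E) (measurable_gaussDensity F)]
  have hm : Measurable fun z : E × F => gaussDensity E z.1 * gaussDensity F z.2 :=
    ((measurable_gaussDensity E).comp measurable_fst).mul
      ((measurable_gaussDensity F).comp measurable_snd)
  ext s hs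
  rw [Measure.map_apply hf.measurable hs, withDensity_apply _ (hf.measurable hs),
    withDensity_apply _ hs]
  change _ = ∫⁻ z in s, gaussDensity E z.1 * gaussDensity F z.2
  rw [← hf.setLIntegral_comp_preimage hs hm]
  refine lintegral_congr fun x => ?_
  have hfin : Module.finrank ℝ (WithLp 2 (E × F)) = Module.finrank ℝ E + Module.finrank ℝ F := by
    rw [(WithLp.linearEquiv 2 ℝ (E × F)).finrank_eq, Module.finrank_prod]
  rw [gaussDensity, gaussDensity, gaussDensity, ← ENNReal.ofReal_mul (by positivity), hfin,
    WithLp.prod_norm_sq_eq_of_L2, neg_add, Real.exp_add, Nat.cast_add, add_div, neg_add,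
    Real.rpow_add Real.pi_pos]
  congr 1
  change _ = Real.pi ^ _ * Real.exp (-‖x.fst‖ ^ 2) * (Real.pi ^ _ * Real.exp (-‖x.snd‖ ^ 2))
  ring

end Gaussian

/-! ### The law of the Gaussian determinant -/

namespace DysonIndex

theorem finrank_scalar (β : DysonIndex) : Module.finrank ℝ β.Scalar = β.val := by
  cases β
  · exact Module.finrank_self ℝ
  · exact Complex.finrank_real_complex
  · exact Quaternion.finrank_eq_four

theorem finrank_column (β : DysonIndex) (N : ℕ) :
    Module.finrank ℝ (β.Column N) = β.val * N := by
  rw [(WithLp.linearEquiv 2 ℝ (Fin N → β.Scalar)).finrank_eq, Module.finrank_pi_fintype]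
  simp [finrank_scalar, mul_comm]

/-- Splitting off the first entry of a column. -/
def columnEquivProd (β : DysonIndex) (N : ℕ) :
    β.Column (N + 1) ≃ₗᵢ[ℝ] WithLp 2 (β.Scalar × β.Column N) where
  toFun m := WithLp.toLp 2 (m 0, tail m)
  invFun p := WithLp.toLp 2 (Fin.cons p.fst p.snd.ofLp)
  map_add' _ _ := rfl
  map_smul' _ _ := rfl
  left_inv m := by
    ext i
    refine Fin.cases ?_ (fun i => ?_) i <;> rfl
  right_inv _ := rfl
  norm_map' m := by
    change ‖WithLp.toLp 2 (m 0, tail m)‖ = ‖m‖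
    rw [← sq_eq_sq₀ (norm_nonneg _) (norm_nonneg _), WithLp.prod_norm_sq_eq_of_L2,
      PiLp.norm_sq_eq_of_L2 _ m, Fin.sum_univ_succ]
    change _ + ‖tail m‖ ^ 2 = _
    rw [PiLp.norm_sq_eq_of_L2]
    rfl

/-- The Gaussian probability measure on columns. -/
def gaussColumn (β : DysonIndex) (N : ℕ) : Measure (β.Column N) := gaussMeasure (β.Column N)

instance (β : DysonIndex) (N : ℕ) : IsProbabilityMeasure (gaussColumn β N) :=
  inferInstanceAs (IsProbabilityMeasure (gaussMeasure (β.Column N)))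

theorem measurePreserving_tail (β : DysonIndex) (N : ℕ) :
    MeasurePreserving (tail : β.Column (N + 1) → β.Column N) (gaussColumn β _) (gaussColumn β _) :=
  (measurePreserving_snd.comp measurePreserving_ofLp_gaussMeasure).comp
    (columnEquivProd β N).measurePreserving_gaussMeasure

theorem measurable_absDet {β : DysonIndex} {N : ℕ} :
    Measurable fun m : Fin N → β.Column N => absDet β (ofColumns m) :=
  continuous_absDet.measurable

/-- The law of `|det M|` for a matrix with independent Gaussian columns. -/
def absDetLaw (β : DysonIndex) (N : ℕ) : Measure ℝ :=
  (Measure.pi fun _ : Fin N => gaussColumn β N).map fun m => absDet β (ofColumns m)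

instance (β : DysonIndex) (N : ℕ) : IsProbabilityMeasure (absDetLaw β N) :=
  Measure.isProbabilityMeasure_map measurable_absDet.aemeasurable

/-- The Gaussian `|det M|` of size `N + 1` is distributed as the product of independent copies of
the norm of a Gaussian column and of the Gaussian `|det M|` of size `N`. -/
theorem absDetLaw_succ (β : DysonIndex) (N : ℕ) :
    absDetLaw β (N + 1) =
      ((gaussColumn β (N + 1)).prod (absDetLaw β N)).map fun p => ‖p.1‖ * p.2 := by
  have hmul : Measurable fun p : β.Column (N + 1) × ℝ => ‖p.1‖ * p.2 := by fun_prop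
  refine Measure.ext_of_lintegral _ fun F hF => ?_
  have hFmul : Measurable fun p : β.Column (N + 1) × ℝ => F (‖p.1‖ * p.2) := hF.comp hmul
  rw [absDetLaw, lintegral_map hF measurable_absDet, lintegral_map hF hmul,
    lintegral_prod _ hFmul.aemeasurable,
    lintegral_pi_succ _ (F := fun m => F (absDet β (ofColumns m))) (hF.comp measurable_absDet)]
  refine lintegral_congr fun v => ?_
  -- The isometry depends on `v`, but `v` is fixed in the inner integral, so no measurable choice is
  -- needed; invariance of the Gaussian law then removes `U`.
  obtain ⟨U, hU⟩ := exists_linearIsometryEquiv_absDet_cons v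
  have hpi : MeasurePreserving (fun (m : Fin N → β.Column (N + 1)) i => tail (U (m i)))
      (Measure.pi fun _ => gaussColumn β (N + 1)) (Measure.pi fun _ => gaussColumn β N) :=
    measurePreserving_pi _ _ fun _ =>
      (measurePreserving_tail β N).comp U.measurePreserving_gaussMeasure
  have hG : Measurable fun m : Fin N → β.Column N => F (‖v‖ * absDet β (ofColumns m)) :=
    hF.comp (measurable_absDet.const_mul _)
  have hFv : Measurable fun y : ℝ => F (‖v‖ * y) := hF.comp (measurable_id.const_mul _)
  rw [absDetLaw, lintegral_map hFv measurable_absDet,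
    ← hpi.lintegral_comp hG]
  refine lintegral_congr fun m => ?_
  exact congrArg F (hU m)

end DysonIndex

/-! ### Radial integrals as Mellin transforms -/

section Radial

open Set

/-- The Jacobian `y^(d-1)` of polar coordinates moves the Mellin variable to `d + q`; `1 ≤ d` keeps
the natural subtraction honest. -/
theorem pow_smul_mul_cpow {d : ℕ} (hd : 1 ≤ d) (φ : ℝ → ℂ) (q : ℂ) {y : ℝ} (hy : 0 < y) :
    y ^ (d - 1) • (φ y * (y : ℂ) ^ q) = (y : ℂ) ^ ((d + q) - 1) • φ y := by
  have h : (y : ℂ) ^ ((d + q) - 1) = (y : ℂ) ^ (d - 1) * (y : ℂ) ^ q := by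
    rw [← Complex.cpow_natCast, ← Complex.cpow_add _ _ (by exact_mod_cast hy.ne')]
    congr 1
    push_cast [hd]
    ring
  rw [h, Complex.real_smul, smul_eq_mul]
  push_cast
  ring

theorem integrable_volumeIoiPow_iff {d : ℕ} (hd : 1 ≤ d) (φ : ℝ → ℂ) (q : ℂ) :
    Integrable (fun r : Ioi (0 : ℝ) => φ r * ((r : ℝ) : ℂ) ^ q) (Measure.volumeIoiPow (d - 1)) ↔
      MellinConvergent φ (d + q) := by
  rw [Measure.volumeIoiPow, integrable_withDensity_iff_integrable_smul' (by fun_prop) (by simp),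
    MellinConvergent, integrableOn_iff_comap_subtypeVal measurableSet_Ioi]
  refine integrable_congr (.of_forall fun r => ?_)
  have hr : (0 : ℝ) < r := r.2
  beta_reduce
  rw [ENNReal.toReal_ofReal (by positivity), pow_smul_mul_cpow hd φ q hr]
  rfl

theorem integral_volumeIoiPow {d : ℕ} (hd : 1 ≤ d) (φ : ℝ → ℂ) (q : ℂ) :
    ∫ r : Ioi (0 : ℝ), φ r * ((r : ℝ) : ℂ) ^ q ∂(Measure.volumeIoiPow (d - 1)) =
      mellin φ (d + q) := by
  simp only [Measure.volumeIoiPow, ENNReal.ofReal]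
  rw [integral_withDensity_eq_integral_smul (by fun_prop), mellin,
    ← integral_subtype_comap measurableSet_Ioi fun y : ℝ => (y : ℂ) ^ ((d + q : ℂ) - 1) • φ y]
  refine integral_congr_ae (.of_forall fun r => ?_)
  have hr : (0 : ℝ) < r := r.2
  beta_reduce
  rw [← pow_smul_mul_cpow hd φ q hr]
  simp only [NNReal.smul_def, Real.coe_toNNReal _ (pow_nonneg hr.le _)]

/-- Near `0` the integrand dominates a multiple of `t^(Re s - 1)`, which is integrable there only
for `Re s > 0`. -/
theorem re_pos_of_mellinConvergent {φ : ℝ → ℂ} {s : ℂ} {c : ℝ} (hc : 0 < c)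
    (hφ : ∀ t ∈ Ioo (0 : ℝ) 1, c ≤ ‖φ t‖) (h : MellinConvergent φ s) : 0 < s.re := by
  have h1 : IntegrableOn (fun t : ℝ => (t : ℂ) ^ (s - 1) • φ t) (Ioo 0 1) :=
    IntegrableOn.mono_set h Ioo_subset_Ioi_self
  have h2 : IntegrableOn (fun t : ℝ => t ^ (s.re - 1)) (Ioo 0 1) := by
    refine Integrable.mono' (h1.norm.const_mul c⁻¹) ?_ ?_
    · exact (measurable_id.pow_const _).aestronglyMeasurable
    · refine (ae_restrict_iff' measurableSet_Ioo).2 (.of_forall fun t ht => ?_)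
      rw [norm_smul, Complex.norm_cpow_eq_rpow_re_of_pos ht.1, Complex.sub_re, Complex.one_re,
        Real.norm_of_nonneg (Real.rpow_nonneg ht.1.le _), mul_left_comm]
      refine le_mul_of_one_le_right (Real.rpow_nonneg ht.1.le _) ?_
      rw [inv_mul_eq_div, one_le_div hc]
      exact hφ t ht
  have := (intervalIntegral.integrableOn_Ioo_rpow_iff one_pos).1 h2
  linarith

/-- The radial Gaussian weight. -/
def gaussWeight (t : ℝ) : ℂ := (Real.exp (-t ^ 2) : ℂ)

/-- The indicator function of the unit ball as a function of the radius. -/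
def ballWeight : ℝ → ℂ := indicator (Iic 1) fun _ => 1

theorem measurable_gaussWeight : Measurable gaussWeight := by
  unfold gaussWeight
  fun_prop

theorem measurable_ballWeight : Measurable ballWeight :=
  measurable_const.indicator measurableSet_Iic

/-- The substitution `x = t²` turns the Mellin transform of the Gaussian into Euler's integral for
`Γ`. -/
theorem gaussWeight_eq :
    gaussWeight = fun t : ℝ => (fun x : ℝ => ((Real.exp (-x) : ℝ) : ℂ)) (t ^ (2 : ℝ)) := by
  ext t
  simp [gaussWeight]

theorem mellinConvergent_gaussWeight {s : ℂ} : MellinConvergent gaussWeight s ↔ 0 < s.re := by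
  constructor
  · refine re_pos_of_mellinConvergent (Real.exp_pos (-1)) fun t ht => ?_
    rw [gaussWeight, Complex.norm_real, Real.norm_of_nonneg (Real.exp_pos _).le]
    refine Real.exp_le_exp.2 (neg_le_neg ?_)
    nlinarith [ht.1, ht.2]
  · intro hs
    rw [gaussWeight_eq, MellinConvergent.comp_rpow (f := fun x : ℝ => ((Real.exp (-x) : ℝ) : ℂ))
      two_ne_zero]
    have h : 0 < (s / (2 : ℝ)).re := by
      rw [Complex.div_ofReal_re]
      positivity
    have h' := Complex.GammaIntegral_convergent h
    refine IntegrableOn.congr_fun h' (fun x _ => ?_) measurableSet_Ioi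
    simp [mul_comm]

theorem mellin_gaussWeight {s : ℂ} (hs : 0 < s.re) :
    mellin gaussWeight s = Complex.Gamma (s / 2) / 2 := by
  have h : 0 < (s / 2).re := by
    rw [show (2 : ℂ) = ((2 : ℝ) : ℂ) by simp, Complex.div_ofReal_re]
    positivity
  rw [gaussWeight_eq, mellin_comp_rpow (fun x : ℝ => ((Real.exp (-x) : ℝ) : ℂ)), ← Complex.GammaIntegral_eq_mellin]
  rw [show s / ((2 : ℝ) : ℂ) = s / 2 by simp, ← Complex.Gamma_eq_integral h]
  simp
  ring

theorem mellin_integrand_ballWeight (s : ℂ) :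
    EqOn (fun t : ℝ => (t : ℂ) ^ (s - 1) • ballWeight t)
      (fun t : ℝ => (t : ℂ) ^ (s - 1) • indicator (Ioc (0 : ℝ) 1) (fun _ => (1 : ℂ)) t) (Ioi 0) := by
  intro t ht
  have ht' : (0 : ℝ) < t := ht
  simp [ballWeight, indicator, ht']

theorem mellinConvergent_ballWeight {s : ℂ} : MellinConvergent ballWeight s ↔ 0 < s.re := by
  constructor
  · refine re_pos_of_mellinConvergent one_pos fun t ht => ?_
    rw [ballWeight, indicator_of_mem (mem_Iic.2 ht.2.le), norm_one]
  · intro hs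
    exact IntegrableOn.congr_fun (hasMellin_one_Ioc hs).1
      (mellin_integrand_ballWeight s).symm measurableSet_Ioi

theorem mellin_ballWeight {s : ℂ} (hs : 0 < s.re) : mellin ballWeight s = 1 / s :=
  (setIntegral_congr_fun measurableSet_Ioi (mellin_integrand_ballWeight s)).trans
    (hasMellin_one_Ioc hs).2

variable {E : Type*} [NormedAddCommGroup E] [InnerProductSpace ℝ E] [FiniteDimensional ℝ E]
  [MeasurableSpace E] [BorelSpace E]

theorem integral_gaussMeasure (f : E → ℂ) :
    ∫ x, f x ∂(gaussMeasure E) =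
      (Real.pi : ℂ) ^ (-(Module.finrank ℝ E / 2 : ℂ)) * ∫ x, gaussWeight ‖x‖ * f x := by
  rw [gaussMeasure, integral_withDensity_eq_integral_toReal_smul (measurable_gaussDensity E)
    (.of_forall fun x => by simp [gaussDensity]), ← integral_const_mul]
  refine integral_congr_ae (.of_forall fun x => ?_)
  simp only [gaussDensity]
  rw [ENNReal.toReal_ofReal (by positivity), Complex.real_smul, Complex.ofReal_mul,
    Complex.ofReal_cpow Real.pi_pos.le, gaussWeight, mul_assoc]
  push_cast
  rfl

theorem integrable_gaussMeasure_iff (f : E → ℂ) :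
    Integrable f (gaussMeasure E) ↔ Integrable fun x => gaussWeight ‖x‖ * f x := by
  rw [gaussMeasure, integrable_withDensity_iff_integrable_smul' (measurable_gaussDensity E)
    (.of_forall fun x => by simp [gaussDensity])]
  have hc : (Real.pi : ℂ) ^ (-(Module.finrank ℝ E / 2 : ℂ)) ≠ 0 := by
    rw [Complex.cpow_def_of_ne_zero (by exact_mod_cast Real.pi_ne_zero)]
    exact Complex.exp_ne_zero _
  rw [← integrable_const_mul_iff (IsUnit.mk0 _ hc) fun x => gaussWeight ‖x‖ * f x]
  refine integrable_congr (.of_forall fun x => ?_)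
  simp only [gaussDensity]
  rw [ENNReal.toReal_ofReal (by positivity), Complex.real_smul, Complex.ofReal_mul,
    Complex.ofReal_cpow Real.pi_pos.le, gaussWeight, mul_assoc]
  push_cast
  rfl

variable [Nontrivial E]

theorem integrable_weight_mul_cpow_norm_iff (φ : ℝ → ℂ) (q : ℂ) :
    Integrable (fun x : E => φ ‖x‖ * (‖x‖ : ℂ) ^ q) ↔
      MellinConvergent φ (Module.finrank ℝ E + q) := by
  rw [integrable_fun_norm_addHaar volume (f := fun y : ℝ => φ y * (y : ℂ) ^ q)]
  exact integrableOn_congr_fun (fun y hy => pow_smul_mul_cpow Module.finrank_pos φ q hy)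
    measurableSet_Ioi

theorem integral_weight_mul_cpow_norm (φ : ℝ → ℂ) (q : ℂ) :
    ∫ x : E, φ ‖x‖ * (‖x‖ : ℂ) ^ q =
      ((volume : Measure E).toSphere.real univ : ℂ) * mellin φ (Module.finrank ℝ E + q) := by
  rw [integral_fun_norm_addHaar volume (fun y : ℝ => φ y * (y : ℂ) ^ q), mellin,
    setIntegral_congr_fun measurableSet_Ioi
      (fun y hy => pow_smul_mul_cpow Module.finrank_pos φ q hy),
    Measure.toSphere_real_apply_univ]
  simp [mul_assoc]

/-- For `l` a dimension this is the Gaussian integral in polar coordinates; for complex `l` it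
serves to trade `Γ` for `sphereArea`. The bound on `l` makes the Gamma factor nonzero. -/
theorem sphereArea_eq_pi_cpow {l : ℂ} (hl : 0 < l.re) :
    sphereArea l * (Complex.Gamma (l / 2) / 2) = (Real.pi : ℂ) ^ (l / 2) := by
  have h : 0 < (l / 2).re := by
    rw [show (2 : ℂ) = ((2 : ℝ) : ℂ) by simp, Complex.div_ofReal_re]
    positivity
  have := Complex.Gamma_ne_zero_of_re_pos h
  rw [sphereArea]
  field_simp

theorem sphereArea_ne_zero {l : ℂ} (hl : 0 < l.re) : sphereArea l ≠ 0 := by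
  intro h
  have h1 := sphereArea_eq_pi_cpow hl
  rw [h, zero_mul] at h1
  exact (Complex.cpow_ne_zero_iff_of_exponent_ne_zero (by
    intro h0
    have : l = 0 := by simpa using h0
    simp [this] at hl)).2 (by exact_mod_cast Real.pi_ne_zero) h1.symm

variable (E) in
/-- The total mass of the unit sphere. -/
theorem toSphere_real_univ :
    ((volume : Measure E).toSphere.real univ : ℂ) = sphereArea (Module.finrank ℝ E) := by
  have hd : 0 < ((Module.finrank ℝ E : ℕ) : ℂ).re := by
    rw [Complex.natCast_re]
    exact_mod_cast (Module.finrank_pos : 0 < Module.finrank ℝ E)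
  -- The total Gaussian integral is evaluated in two ways, directly and in polar coordinates.
  have h1 := integral_weight_mul_cpow_norm (E := E) gaussWeight 0
  have h2 : ∫ x : E, gaussWeight ‖x‖ * (‖x‖ : ℂ) ^ (0 : ℂ) =
      (Real.pi : ℂ) ^ ((Module.finrank ℝ E : ℂ) / 2) := by
    simp only [Complex.cpow_zero, mul_one, gaussWeight]
    rw [integral_complex_ofReal, integral_exp_neg_sq_norm, Complex.ofReal_cpow Real.pi_pos.le]
    simp
  rw [h2, add_zero, mellin_gaussWeight hd, ← sphereArea_eq_pi_cpow hd] at h1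
  have h3 : Complex.Gamma ((Module.finrank ℝ E : ℂ) / 2) / 2 ≠ 0 := by
    intro h
    have h4 := sphereArea_eq_pi_cpow hd
    rw [h, mul_zero] at h4
    exact (Complex.cpow_ne_zero_iff_of_exponent_ne_zero (by
      intro h0
      have : (Module.finrank ℝ E : ℂ) = 0 := by simpa using h0
      simp [this] at hd)).2 (by exact_mod_cast Real.pi_ne_zero) h4.symm
  exact (mul_right_cancel₀ h3 h1).symm

theorem integrable_cpow_norm_gaussMeasure_iff (q : ℂ) :
    Integrable (fun x : E => (‖x‖ : ℂ) ^ q) (gaussMeasure E) ↔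
      -(Module.finrank ℝ E : ℝ) < q.re := by
  rw [integrable_gaussMeasure_iff, integrable_weight_mul_cpow_norm_iff,
    mellinConvergent_gaussWeight, Complex.add_re, Complex.natCast_re, neg_lt_iff_pos_add']

/-- The moments of the norm of a Gaussian vector. -/
theorem integral_cpow_norm_gaussMeasure {q : ℂ} (hq : -(Module.finrank ℝ E : ℝ) < q.re) :
    ∫ x : E, (‖x‖ : ℂ) ^ q ∂(gaussMeasure E) =
      (Real.pi : ℂ) ^ (q / 2) *
        (sphereArea (Module.finrank ℝ E) / sphereArea (Module.finrank ℝ E + q)) := by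
  have hs : 0 < ((Module.finrank ℝ E : ℂ) + q).re := by
    rw [Complex.add_re, Complex.natCast_re]; linarith
  have hpi : (Real.pi : ℂ) ≠ 0 := by exact_mod_cast Real.pi_ne_zero
  rw [integral_gaussMeasure, integral_weight_mul_cpow_norm, toSphere_real_univ,
    mellin_gaussWeight hs, eq_div_of_mul_eq (sphereArea_ne_zero hs)
      ((mul_comm _ _).trans (sphereArea_eq_pi_cpow hs)),
    add_div, Complex.cpow_add _ _ hpi, Complex.cpow_neg]
  have h0 : (Real.pi : ℂ) ^ ((Module.finrank ℝ E : ℂ) / 2) ≠ 0 := by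
    rw [Complex.cpow_def_of_ne_zero hpi]
    exact Complex.exp_ne_zero _
  have := sphereArea_ne_zero hs
  field_simp

end Radial

/-! ### Polar coordinates in each column -/

section Polar

open Set Metric

variable (E : Type*) [NormedAddCommGroup E] [InnerProductSpace ℝ E] [FiniteDimensional ℝ E]
  [MeasurableSpace E] [BorelSpace E] [Nontrivial E]

/-- Polar coordinates. -/
theorem measurePreserving_smul_sphere :
    MeasurePreserving (fun p : sphere (0 : E) 1 × Ioi (0 : ℝ) => (p.2 : ℝ) • (p.1 : E))
      ((volume : Measure E).toSphere.prod (Measure.volumeIoiPow (Module.finrank ℝ E - 1)))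
      volume := by
  have h1 := ((volume : Measure E).measurePreserving_homeomorphUnitSphereProd).symm
    (homeomorphUnitSphereProd E).toMeasurableEquiv
  have h2 : MeasurePreserving (Subtype.val : ({0}ᶜ : Set E) → E)
      ((volume : Measure E).comap Subtype.val) volume := by
    refine ⟨measurable_subtype_coe, ?_⟩
    rw [map_comap_subtype_coe (measurableSet_singleton _).compl, restrict_compl_singleton]
  exact h2.comp h1

/-- Polar coordinates in every component of a power. -/
theorem measurePreserving_pi_smul_sphere (N : ℕ) :
    MeasurePreserving
      (fun (p : (Fin N → sphere (0 : E) 1) × (Fin N → Ioi (0 : ℝ))) i =>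
        (p.2 i : ℝ) • (p.1 i : E))
      ((Measure.pi fun _ => (volume : Measure E).toSphere).prod
        (Measure.pi fun _ => Measure.volumeIoiPow (Module.finrank ℝ E - 1)))
      volume := by
  have h1 := (measurePreserving_arrowProdEquivProdArrow (sphere (0 : E) 1) (Ioi (0 : ℝ)) (Fin N)
    (fun _ => (volume : Measure E).toSphere)
    (fun _ => Measure.volumeIoiPow (Module.finrank ℝ E - 1))).symm
  have h2 : MeasurePreserving
      (fun (p : Fin N → sphere (0 : E) 1 × Ioi (0 : ℝ)) i => ((p i).2 : ℝ) • ((p i).1 : E))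
      (Measure.pi fun _ => (volume : Measure E).toSphere.prod
        (Measure.volumeIoiPow (Module.finrank ℝ E - 1)))
      (Measure.pi fun _ => volume) :=
    measurePreserving_pi _ _ fun _ => measurePreserving_smul_sphere E
  exact h2.comp h1

end Polar

/-! ### Separation of radial and spherical integrals; recursion for moments -/

namespace DysonIndex

open Set Metric

/-- The complex power `|det M|^q` of a matrix with columns `m`. -/
def detPow {β : DysonIndex} {N : ℕ} (q : ℂ) (m : Fin N → β.Column N) : ℂ :=
  ((absDet β (ofColumns m) : ℝ) : ℂ) ^ q

variable {β : DysonIndex} {N : ℕ} (q : ℂ)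

theorem measurable_detPow : Measurable (detPow q : (Fin N → β.Column N) → ℂ) :=
  (Complex.measurable_ofReal.comp measurable_absDet).pow_const q

theorem ofReal_prod_cpow {ι : Type*} (s : Finset ι) (r : ι → ℝ) (hr : ∀ i, 0 ≤ r i) :
    ((∏ i ∈ s, r i : ℝ) : ℂ) ^ q = ∏ i ∈ s, (r i : ℂ) ^ q := by
  classical
  induction s using Finset.induction_on with
  | empty => simp
  | insert i s hi ih =>
    rw [Finset.prod_insert hi, Finset.prod_insert hi, Complex.ofReal_mul,
      Complex.mul_cpow_ofReal_nonneg (hr i) (Finset.prod_nonneg fun j _ => hr j), ih]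

theorem detPow_smul (r : Fin N → Ioi (0 : ℝ)) (m : Fin N → β.Column N) :
    detPow q (fun i => (r i : ℝ) • m i) = (∏ i, ((r i : ℝ) : ℂ) ^ q) * detPow q m := by
  have hr : ∀ i, (0 : ℝ) ≤ r i := fun i => (r i).2.out.le
  rw [detPow, absDet_ofColumns_smul, Complex.ofReal_mul, Complex.mul_cpow_ofReal_nonneg
    (Finset.prod_nonneg fun i _ => abs_nonneg _) (absDet_nonneg _), detPow]
  simp only [abs_of_nonneg (hr _)]
  rw [ofReal_prod_cpow q _ _ hr]

theorem weight_mul_detPow_smul (φ : ℝ → ℂ) (r : Fin N → Ioi (0 : ℝ))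
    (s : Fin N → sphere (0 : β.Column N) 1) :
    (∏ i, φ ‖(r i : ℝ) • (s i : β.Column N)‖) * detPow q (fun i => (r i : ℝ) • (s i : β.Column N)) =
      detPow q (fun i => (s i : β.Column N)) * ∏ i, (φ (r i) * ((r i : ℝ) : ℂ) ^ q) := by
  have hr : ∀ i, ‖(r i : ℝ) • (s i : β.Column N)‖ = r i := fun i => by
    rw [norm_smul, norm_eq_of_mem_sphere (s i), mul_one, Real.norm_of_nonneg (r i).2.out.le]
  simp only [hr]
  rw [detPow_smul, Finset.prod_mul_distrib]
  ring

instance : IsFiniteMeasure (surfaceMeasure β N) :=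
  inferInstanceAs (IsFiniteMeasure (volume : Measure (β.Column N)).toSphere)

theorem finrank_column_pos (hN : 1 ≤ N) : 0 < Module.finrank ℝ (β.Column N) := by
  rw [finrank_column]
  cases β <;> simp [val] <;> omega

theorem nontrivial_column (hN : 1 ≤ N) : Nontrivial (β.Column N) :=
  Module.nontrivial_of_finrank_pos (R := ℝ) (finrank_column_pos hN)

theorem measurable_detPow_sphere : Measurable
    fun s : Fin N → sphere (0 : β.Column N) 1 => detPow q fun i => (s i : β.Column N) :=
  (measurable_detPow q).comp
    (measurable_pi_lambda _ fun i => measurable_subtype_coe.comp (measurable_pi_apply i))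

theorem measurable_weight_mul_detPow {φ : ℝ → ℂ} (hφ : Measurable φ) :
    Measurable fun m : Fin N → β.Column N => (∏ i, φ ‖m i‖) * detPow q m :=
  (Finset.measurable_prod _ fun i _ => hφ.comp (measurable_pi_apply i).norm).mul
    (measurable_detPow q)

/-- The law of the radius, up to normalisation. -/
def radiusMeasure (β : DysonIndex) (N : ℕ) : Measure (Ioi (0 : ℝ)) :=
  Measure.volumeIoiPow (Module.finrank ℝ (β.Column N) - 1)

instance : SigmaFinite (radiusMeasure β N) :=
  inferInstanceAs (SigmaFinite (Measure.volumeIoiPow _))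

theorem measurePreserving_polar (hN : 1 ≤ N) :
    MeasurePreserving
      (fun (p : (Fin N → sphere (0 : β.Column N) 1) × (Fin N → Ioi (0 : ℝ))) i =>
        (p.2 i : ℝ) • (p.1 i : β.Column N))
      ((Measure.pi fun _ => surfaceMeasure β N).prod (Measure.pi fun _ => radiusMeasure β N))
      volume :=
  haveI := nontrivial_column (β := β) hN
  measurePreserving_pi_smul_sphere (β.Column N) N

/-- Separation of the radial and the spherical parts of a moment. -/
theorem integral_weight_mul_detPow (hN : 1 ≤ N) {φ : ℝ → ℂ} (hφ : Measurable φ) :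
    ∫ m : Fin N → β.Column N, (∏ i, φ ‖m i‖) * detPow q m =
      (∫ s : Fin N → sphere (0 : β.Column N) 1, detPow q (fun i => (s i : β.Column N))
        ∂(Measure.pi fun _ => surfaceMeasure β N)) *
      (∫ r : Ioi (0 : ℝ), φ r * ((r : ℝ) : ℂ) ^ q ∂(radiusMeasure β N)) ^ N := by
  have h := measurePreserving_polar (β := β) hN
  rw [← h.map_eq, integral_map h.aemeasurable
    (measurable_weight_mul_detPow q hφ).aestronglyMeasurable]
  simp only [weight_mul_detPow_smul]
  -- No integrability is required: the product formulas remain true with the value `0` for a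
  -- divergent integral.
  rw [integral_prod_mul (fun s : Fin N → sphere (0 : β.Column N) 1 =>
      detPow q fun i => (s i : β.Column N))
    (fun r : Fin N → Ioi (0 : ℝ) => ∏ i, (φ (r i) * ((r i : ℝ) : ℂ) ^ q)),
    integral_fintype_prod_eq_pow (ι := Fin N)
      (fun r : Ioi (0 : ℝ) => φ r * ((r : ℝ) : ℂ) ^ q), Fintype.card_fin]

/-- The counterpart in `[0, ∞]`, through which convergence passes between the sphere and the
weighted integrals in both directions. -/
theorem lintegral_weight_mul_detPow (hN : 1 ≤ N) {φ : ℝ → ℂ} (hφ : Measurable φ) :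
    ∫⁻ m : Fin N → β.Column N, ‖(∏ i, φ ‖m i‖) * detPow q m‖ₑ =
      (∫⁻ s : Fin N → sphere (0 : β.Column N) 1, ‖detPow q (fun i => (s i : β.Column N))‖ₑ
        ∂(Measure.pi fun _ => surfaceMeasure β N)) *
      (∫⁻ r : Ioi (0 : ℝ), ‖φ r * ((r : ℝ) : ℂ) ^ q‖ₑ ∂(radiusMeasure β N)) ^ N := by
  have h := measurePreserving_polar (β := β) hN
  have hr : Measurable fun r : Ioi (0 : ℝ) => ‖φ r * ((r : ℝ) : ℂ) ^ q‖ₑ :=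
    ((hφ.comp measurable_subtype_coe).mul
      ((Complex.measurable_ofReal.comp measurable_subtype_coe).pow_const q)).enorm
  rw [← h.lintegral_comp (measurable_weight_mul_detPow q hφ).enorm]
  have hprod : ∀ r : Fin N → Ioi (0 : ℝ), ‖∏ i, (φ (r i) * ((r i : ℝ) : ℂ) ^ q)‖ₑ =
      ∏ i, ‖φ (r i) * ((r i : ℝ) : ℂ) ^ q‖ₑ := fun r => by
    simp only [enorm_eq_nnnorm, nnnorm_prod, ENNReal.ofNNReal_finsetProd]
  simp only [weight_mul_detPow_smul, enorm_mul (detPow q _), hprod]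
  rw [lintegral_prod_mul (f := fun s : Fin N → sphere (0 : β.Column N) 1 =>
      ‖detPow q fun i => (s i : β.Column N)‖ₑ)
    (g := fun r : Fin N → Ioi (0 : ℝ) => ∏ i, ‖φ (r i) * ((r i : ℝ) : ℂ) ^ q‖ₑ)
    (measurable_detPow_sphere q).enorm.aemeasurable
    (Finset.measurable_prod _ fun i _ => hr.comp (measurable_pi_apply i)).aemeasurable,
    lintegral_fin_prod_eq_prod (fun _ : Fin N => radiusMeasure β N) (fun _ => hr)]
  simp

/-- Gaussian columns, in terms of Lebesgue measure. -/
theorem pi_gaussColumn :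
    (Measure.pi fun _ : Fin N => gaussColumn β N) =
      volume.withDensity fun m : Fin N → β.Column N => ∏ i, gaussDensity (β.Column N) (m i) := by
  have : SigmaFinite ((volume : Measure (β.Column N)).withDensity
      (gaussDensity (β.Column N))) :=
    inferInstanceAs (SigmaFinite (gaussMeasure (β.Column N)))
  exact pi_withDensity_fin (volume : Measure (β.Column N)) (measurable_gaussDensity _)

theorem gaussDensity_toReal_prod (m : Fin N → β.Column N) (z : ℂ) :
    (∏ i, gaussDensity (β.Column N) (m i)).toReal • z =
      ((Real.pi : ℂ) ^ (-(Module.finrank ℝ (β.Column N) / 2 : ℂ))) ^ N *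
        ((∏ i, gaussWeight ‖m i‖) * z) := by
  have h : ∀ i, ((gaussDensity (β.Column N) (m i)).toReal : ℂ) =
      (Real.pi : ℂ) ^ (-(Module.finrank ℝ (β.Column N) / 2 : ℂ)) * gaussWeight ‖m i‖ := fun i => by
    rw [gaussDensity, ENNReal.toReal_ofReal (by positivity), Complex.ofReal_mul,
      Complex.ofReal_cpow Real.pi_pos.le, gaussWeight]
    push_cast
    rfl
  rw [ENNReal.toReal_prod, Complex.real_smul, Complex.ofReal_prod]
  simp only [h]
  rw [Finset.prod_mul_distrib]
  simp [mul_assoc]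

theorem pi_cpow_ne_zero (z : ℂ) : (Real.pi : ℂ) ^ z ≠ 0 := by
  rw [Complex.cpow_def_of_ne_zero (by exact_mod_cast Real.pi_ne_zero)]
  exact Complex.exp_ne_zero _

theorem measurable_prod_gaussDensity :
    Measurable fun m : Fin N → β.Column N => ∏ i, gaussDensity (β.Column N) (m i) :=
  Finset.measurable_prod _ fun i _ => (measurable_gaussDensity _).comp (measurable_pi_apply i)

theorem prod_gaussDensity_lt_top (m : Fin N → β.Column N) :
    ∏ i, gaussDensity (β.Column N) (m i) < ∞ :=
  ENNReal.prod_lt_top fun _ _ => ENNReal.ofReal_lt_top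

theorem integral_pi_gaussColumn (f : (Fin N → β.Column N) → ℂ) :
    ∫ m, f m ∂(Measure.pi fun _ => gaussColumn β N) =
      ((Real.pi : ℂ) ^ (-(Module.finrank ℝ (β.Column N) / 2 : ℂ))) ^ N *
        ∫ m : Fin N → β.Column N, (∏ i, gaussWeight ‖m i‖) * f m := by
  rw [pi_gaussColumn, integral_withDensity_eq_integral_toReal_smul measurable_prod_gaussDensity
    (.of_forall prod_gaussDensity_lt_top), ← integral_const_mul]
  exact integral_congr_ae (.of_forall fun m => gaussDensity_toReal_prod m (f m))

theorem integrable_pi_gaussColumn_iff (f : (Fin N → β.Column N) → ℂ) :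
    Integrable f (Measure.pi fun _ => gaussColumn β N) ↔
      Integrable fun m : Fin N → β.Column N => (∏ i, gaussWeight ‖m i‖) * f m := by
  rw [pi_gaussColumn, integrable_withDensity_iff_integrable_smul' measurable_prod_gaussDensity
    (.of_forall prod_gaussDensity_lt_top),
    ← integrable_const_mul_iff (IsUnit.mk0 _ (pow_ne_zero N (pi_cpow_ne_zero
      (-(Module.finrank ℝ (β.Column N) / 2 : ℂ)))))
      fun m : Fin N → β.Column N => (∏ i, gaussWeight ‖m i‖) * f m]
  exact integrable_congr (.of_forall fun m => gaussDensity_toReal_prod m (f m))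

theorem measurable_ofReal_cpow : Measurable fun x : ℝ => (x : ℂ) ^ q :=
  Complex.measurable_ofReal.pow_const q

theorem absDetLaw_nonneg : ∀ᵐ y ∂(absDetLaw β N), 0 ≤ y :=
  (ae_map_iff measurable_absDet.aemeasurable measurableSet_Ici).2
    (.of_forall fun _ => absDet_nonneg _)

/-- Complex powers are multiplicative on nonnegative reals, and `absDetLaw` is concentrated there.
-/
theorem norm_mul_cpow_ae : ∀ᵐ p ∂((gaussColumn β (N + 1)).prod (absDetLaw β N)),
    ((‖p.1‖ * p.2 : ℝ) : ℂ) ^ q = (‖p.1‖ : ℂ) ^ q * (p.2 : ℂ) ^ q := by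
  filter_upwards [Measure.quasiMeasurePreserving_snd.ae absDetLaw_nonneg] with p hp
  rw [Complex.ofReal_mul, Complex.mul_cpow_ofReal_nonneg (norm_nonneg _) hp]

theorem integral_detPow_eq_absDetLaw :
    ∫ m, detPow q m ∂(Measure.pi fun _ => gaussColumn β N) =
      ∫ y : ℝ, (y : ℂ) ^ q ∂(absDetLaw β N) := by
  rw [absDetLaw, integral_map measurable_absDet.aemeasurable
    (measurable_ofReal_cpow q).aestronglyMeasurable]
  rfl

theorem lintegral_detPow_eq_absDetLaw :
    ∫⁻ m, ‖detPow q m‖ₑ ∂(Measure.pi fun _ => gaussColumn β N) =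
      ∫⁻ y : ℝ, ‖(y : ℂ) ^ q‖ₑ ∂(absDetLaw β N) := by
  rw [absDetLaw, lintegral_map (measurable_ofReal_cpow q).enorm measurable_absDet]
  rfl

theorem integral_absDetLaw_succ :
    ∫ y : ℝ, (y : ℂ) ^ q ∂(absDetLaw β (N + 1)) =
      (∫ x, (‖x‖ : ℂ) ^ q ∂(gaussColumn β (N + 1))) * ∫ y : ℝ, (y : ℂ) ^ q ∂(absDetLaw β N) := by
  have hmul : Measurable fun p : β.Column (N + 1) × ℝ => ‖p.1‖ * p.2 := by fun_prop
  rw [absDetLaw_succ, integral_map hmul.aemeasurable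
    (measurable_ofReal_cpow q).aestronglyMeasurable, integral_congr_ae (norm_mul_cpow_ae q),
    integral_prod_mul (fun x : β.Column (N + 1) => (‖x‖ : ℂ) ^ q) (fun y : ℝ => (y : ℂ) ^ q)]

theorem lintegral_absDetLaw_succ :
    ∫⁻ y : ℝ, ‖(y : ℂ) ^ q‖ₑ ∂(absDetLaw β (N + 1)) =
      (∫⁻ x, ‖(‖x‖ : ℂ) ^ q‖ₑ ∂(gaussColumn β (N + 1))) *
        ∫⁻ y : ℝ, ‖(y : ℂ) ^ q‖ₑ ∂(absDetLaw β N) := by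
  have hmul : Measurable fun p : β.Column (N + 1) × ℝ => ‖p.1‖ * p.2 := by fun_prop
  rw [absDetLaw_succ, lintegral_map (measurable_ofReal_cpow q).enorm hmul,
    ← lintegral_prod_mul (f := fun x : β.Column (N + 1) => ‖(‖x‖ : ℂ) ^ q‖ₑ)
      (g := fun y : ℝ => ‖(y : ℂ) ^ q‖ₑ)
      ((measurable_ofReal_cpow q).comp measurable_norm).enorm.aemeasurable
      (measurable_ofReal_cpow q).enorm.aemeasurable]
  refine lintegral_congr_ae ((norm_mul_cpow_ae q).mono fun p hp => ?_)
  change ‖((‖p.1‖ * p.2 : ℝ) : ℂ) ^ q‖ₑ = _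
  rw [hp, enorm_mul]

end DysonIndex

/-! ### Exact range of convergence and values of the moments -/

theorem integrable_iff_lintegral_enorm_lt_top {α : Type*} [MeasurableSpace α] {μ : Measure α}
    {f : α → ℂ} (hf : Measurable f) : Integrable f μ ↔ ∫⁻ x, ‖f x‖ₑ ∂μ < ∞ := by
  rw [Integrable, hasFiniteIntegral_iff_enorm]
  exact and_iff_right hf.aestronglyMeasurable

/-- In `[0, ∞]` a finite product bounds a factor only if the other factor is nonzero; nonvanishing
is obtained from explicit values of the integrals. -/
theorem lintegral_enorm_ne_zero {α : Type*} [MeasurableSpace α] {μ : Measure α} {f : α → ℂ}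
    (h : ∫ x, f x ∂μ ≠ 0) : ∫⁻ x, ‖f x‖ₑ ∂μ ≠ 0 := by
  intro h0
  have h1 := enorm_integral_le_lintegral_enorm (μ := μ) f
  rw [h0, nonpos_iff_eq_zero, enorm_eq_zero] at h1
  exact h h1

namespace DysonIndex

open Set Metric

variable {β : DysonIndex} {N : ℕ} {q : ℂ}

theorem val_pos (β : DysonIndex) : 0 < β.val := by
  cases β <;> simp [val]

theorem neg_val_mul_lt (hN : 1 ≤ N) (hq : -(β.val : ℝ) < q.re) :
    -(Module.finrank ℝ (β.Column N) : ℝ) < q.re := by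
  rw [finrank_column, Nat.cast_mul]
  have h1 : (1 : ℝ) ≤ N := by exact_mod_cast hN
  nlinarith [(Nat.cast_nonneg β.val : (0 : ℝ) ≤ β.val)]

theorem re_finrank_add_pos (hq : -(Module.finrank ℝ (β.Column N) : ℝ) < q.re) :
    0 < ((Module.finrank ℝ (β.Column N) : ℂ) + q).re := by
  rw [Complex.add_re, Complex.natCast_re]
  linarith

theorem lintegral_norm_gaussColumn_lt_top_iff (hN : 1 ≤ N) :
    ∫⁻ x, ‖(‖x‖ : ℂ) ^ q‖ₑ ∂(gaussColumn β N) < ∞ ↔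
      -(Module.finrank ℝ (β.Column N) : ℝ) < q.re := by
  have := nontrivial_column (β := β) hN
  rw [← integrable_cpow_norm_gaussMeasure_iff (E := β.Column N) q]
  exact (integrable_iff_lintegral_enorm_lt_top
    ((measurable_ofReal_cpow q).comp measurable_norm)).symm

/-- A vanishing integral would be finite, so the explicit formula would apply, and its value is not
zero. -/
theorem lintegral_norm_gaussColumn_ne_zero (hN : 1 ≤ N) :
    ∫⁻ x, ‖(‖x‖ : ℂ) ^ q‖ₑ ∂(gaussColumn β N) ≠ 0 := by
  intro h
  have := nontrivial_column (β := β) hN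
  have hq := (lintegral_norm_gaussColumn_lt_top_iff hN).1 (h.trans_lt ENNReal.zero_lt_top)
  refine lintegral_enorm_ne_zero ?_ h
  rw [gaussColumn, integral_cpow_norm_gaussMeasure hq]
  refine mul_ne_zero (pi_cpow_ne_zero _) (div_ne_zero (sphereArea_ne_zero ?_)
    (sphereArea_ne_zero (re_finrank_add_pos hq)))
  rw [Complex.natCast_re]
  exact_mod_cast finrank_column_pos hN

theorem ae_absDetLaw_zero : ∀ᵐ y ∂(absDetLaw β 0), y = 1 :=
  (ae_map_iff measurable_absDet.aemeasurable (measurableSet_singleton 1)).2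
    (.of_forall fun m => absDet_ofColumns_zero m)

theorem lintegral_absDetLaw_zero : ∫⁻ y : ℝ, ‖(y : ℂ) ^ q‖ₑ ∂(absDetLaw β 0) = 1 := by
  rw [lintegral_congr_ae (ae_absDetLaw_zero.mono fun y hy =>
    show ‖(y : ℂ) ^ q‖ₑ = 1 by rw [hy]; simp)]
  simp

theorem integral_absDetLaw_zero : ∫ y : ℝ, (y : ℂ) ^ q ∂(absDetLaw β 0) = 1 := by
  rw [integral_congr_ae (ae_absDetLaw_zero.mono fun y hy =>
    show (y : ℂ) ^ q = 1 by rw [hy]; simp)]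
  simp

theorem lintegral_absDetLaw_lt_top (hq : -(β.val : ℝ) < q.re) :
    ∫⁻ y : ℝ, ‖(y : ℂ) ^ q‖ₑ ∂(absDetLaw β N) < ∞ := by
  induction N with
  | zero => rw [lintegral_absDetLaw_zero]; exact ENNReal.one_lt_top
  | succ N ih =>
    rw [lintegral_absDetLaw_succ]
    exact ENNReal.mul_lt_top ((lintegral_norm_gaussColumn_lt_top_iff (by omega)).2
      (neg_val_mul_lt (by omega) hq)) ih

/-- The factors of larger dimension are nonzero, so finiteness descends to size `1`, whose column
has dimension `β` and gives the strictest bound on `q`. -/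
theorem neg_val_lt_of_lintegral_absDetLaw (hN : 1 ≤ N)
    (h : ∫⁻ y : ℝ, ‖(y : ℂ) ^ q‖ₑ ∂(absDetLaw β N) < ∞) : -(β.val : ℝ) < q.re := by
  induction N, hN using Nat.le_induction with
  | base =>
    rw [lintegral_absDetLaw_succ, lintegral_absDetLaw_zero, mul_one,
      lintegral_norm_gaussColumn_lt_top_iff le_rfl, finrank_column] at h
    simpa using h
  | succ N hN ih =>
    rw [lintegral_absDetLaw_succ] at h
    exact ih (ENNReal.lt_top_of_mul_ne_top_right h.ne (lintegral_norm_gaussColumn_ne_zero (by omega)))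

/-- The product of ratios of sphere areas in the moments of the determinant. -/
def areaProd (β : DysonIndex) (N : ℕ) (q : ℂ) : ℂ :=
  ∏ k ∈ Finset.range N,
    sphereArea ((β.val : ℂ) * (k + 1)) / sphereArea ((β.val : ℂ) * (k + 1) + q)

theorem areaProd_ne_zero (hq : -(β.val : ℝ) < q.re) : areaProd β N q ≠ 0 := by
  refine Finset.prod_ne_zero_iff.2 fun k _ => ?_
  have hβ : (0 : ℝ) < β.val := by exact_mod_cast val_pos β
  have e : (((β.val : ℂ) * (k + 1))).re = β.val * (k + 1) := by
    rw [show ((β.val : ℂ) * (k + 1)) = ((β.val * (k + 1) : ℝ) : ℂ) by push_cast; rfl,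
      Complex.ofReal_re]
  have hk : (0 : ℝ) ≤ k := Nat.cast_nonneg k
  refine div_ne_zero (sphereArea_ne_zero ?_) (sphereArea_ne_zero ?_)
  · rw [e]; positivity
  · rw [Complex.add_re, e]; nlinarith

/-- The moments of `|det M|` for a matrix with independent Gaussian columns. -/
theorem integral_absDetLaw (hq : -(β.val : ℝ) < q.re) :
    ∫ y : ℝ, (y : ℂ) ^ q ∂(absDetLaw β N) = ((Real.pi : ℂ) ^ (q / 2)) ^ N * areaProd β N q := by
  induction N with
  | zero => simp [integral_absDetLaw_zero, areaProd]
  | succ N ih =>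
    have := nontrivial_column (β := β) (N := N + 1) (by omega)
    rw [integral_absDetLaw_succ, ih, gaussColumn,
      integral_cpow_norm_gaussMeasure (neg_val_mul_lt (by omega) hq), finrank_column, areaProd,
      areaProd, Finset.prod_range_succ, pow_succ]
    push_cast
    ring

theorem integrable_detPow_gauss_iff (hN : 1 ≤ N) :
    Integrable (fun m : Fin N → β.Column N => (∏ i, gaussWeight ‖m i‖) * detPow q m) ↔
      -(β.val : ℝ) < q.re := by
  rw [← integrable_pi_gaussColumn_iff, integrable_iff_lintegral_enorm_lt_top (measurable_detPow q),
    lintegral_detPow_eq_absDetLaw]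
  exact ⟨neg_val_lt_of_lintegral_absDetLaw hN, lintegral_absDetLaw_lt_top⟩

theorem integral_detPow_gauss (hq : -(β.val : ℝ) < q.re) :
    ∫ m : Fin N → β.Column N, (∏ i, gaussWeight ‖m i‖) * detPow q m =
      ((Real.pi : ℂ) ^ ((Module.finrank ℝ (β.Column N) + q) / 2)) ^ N * areaProd β N q := by
  have h := integral_pi_gaussColumn (β := β) (N := N) (detPow q)
  rw [integral_detPow_eq_absDetLaw, integral_absDetLaw hq, Complex.cpow_neg] at h
  rw [add_div, Complex.cpow_add _ _ (by exact_mod_cast Real.pi_ne_zero), mul_pow, mul_assoc, h,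
    inv_pow, mul_inv_cancel_left₀ (pow_ne_zero _ (pi_cpow_ne_zero _))]

theorem lintegral_radius_lt_top_iff (hN : 1 ≤ N) {φ : ℝ → ℂ} (hφ : Measurable φ) :
    ∫⁻ r : Ioi (0 : ℝ), ‖φ r * ((r : ℝ) : ℂ) ^ q‖ₑ ∂(radiusMeasure β N) < ∞ ↔
      MellinConvergent φ (Module.finrank ℝ (β.Column N) + q) := by
  rw [← integrable_volumeIoiPow_iff (finrank_column_pos hN)]
  exact (integrable_iff_lintegral_enorm_lt_top ((hφ.comp measurable_subtype_coe).mul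
    ((measurable_ofReal_cpow q).comp measurable_subtype_coe))).symm

theorem lintegral_radius_ne_zero (hN : 1 ≤ N) {φ : ℝ → ℂ}
    (h : mellin φ (Module.finrank ℝ (β.Column N) + q) ≠ 0) :
    ∫⁻ r : Ioi (0 : ℝ), ‖φ r * ((r : ℝ) : ℂ) ^ q‖ₑ ∂(radiusMeasure β N) ≠ 0 := by
  refine lintegral_enorm_ne_zero ?_
  rwa [radiusMeasure, integral_volumeIoiPow (finrank_column_pos hN)]

theorem mellin_gaussWeight_ne_zero {s : ℂ} (hs : 0 < s.re) : mellin gaussWeight s ≠ 0 := by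
  intro h
  have h1 := sphereArea_eq_pi_cpow hs
  rw [← mellin_gaussWeight hs, h, mul_zero] at h1
  exact pi_cpow_ne_zero _ h1.symm

theorem mellin_ballWeight_ne_zero {s : ℂ} (hs : 0 < s.re) : mellin ballWeight s ≠ 0 := by
  rw [mellin_ballWeight hs]
  refine one_div_ne_zero fun h => ?_
  simp [h] at hs

/-- The integral of `|det M|^q` over columns on the unit sphere is not identically degenerate. -/
theorem lintegral_sphere_ne_zero (hN : 1 ≤ N) :
    ∫⁻ s : Fin N → sphere (0 : β.Column N) 1, ‖detPow q (fun i => (s i : β.Column N))‖ₑ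
      ∂(Measure.pi fun _ => surfaceMeasure β N) ≠ 0 := by
  intro h
  have h0 := lintegral_weight_mul_detPow (β := β) q hN measurable_gaussWeight
  -- Since `0 * ∞ = 0`, the Gaussian integral would vanish too, hence converge, against its explicit
  -- nonzero value.
  rw [h, zero_mul] at h0
  have hq : -(β.val : ℝ) < q.re := by
    rw [← integrable_detPow_gauss_iff hN, integrable_iff_lintegral_enorm_lt_top
      (measurable_weight_mul_detPow q measurable_gaussWeight), h0]
    exact ENNReal.zero_lt_top
  refine lintegral_enorm_ne_zero ?_ h0
  rw [integral_detPow_gauss hq]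
  exact mul_ne_zero (pow_ne_zero _ (pi_cpow_ne_zero _)) (areaProd_ne_zero hq)

theorem integrable_detPow_sphere (hN : 1 ≤ N) (hq : -(β.val : ℝ) < q.re) :
    Integrable (fun s : Fin N → sphere (0 : β.Column N) 1 => detPow q fun i => (s i : β.Column N))
      (Measure.pi fun _ => surfaceMeasure β N) := by
  rw [integrable_iff_lintegral_enorm_lt_top (measurable_detPow_sphere q)]
  have h := (integrable_detPow_gauss_iff hN).2 hq
  rw [integrable_iff_lintegral_enorm_lt_top
    (measurable_weight_mul_detPow q measurable_gaussWeight),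
    lintegral_weight_mul_detPow q hN measurable_gaussWeight] at h
  exact ENNReal.lt_top_of_mul_ne_top_left h.ne (pow_ne_zero _ (lintegral_radius_ne_zero hN
    (mellin_gaussWeight_ne_zero (re_finrank_add_pos (neg_val_mul_lt hN hq)))))

/-- For `Re q > -βN` the radial Gaussian factor is finite, so convergence on the sphere carries over
to the Gaussian integral. -/
theorem neg_val_lt_of_lintegral_sphere (hN : 1 ≤ N)
    (hq : -(Module.finrank ℝ (β.Column N) : ℝ) < q.re)
    (h : ∫⁻ s : Fin N → sphere (0 : β.Column N) 1, ‖detPow q (fun i => (s i : β.Column N))‖ₑ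
      ∂(Measure.pi fun _ => surfaceMeasure β N) < ∞) : -(β.val : ℝ) < q.re := by
  rw [← integrable_detPow_gauss_iff hN, integrable_iff_lintegral_enorm_lt_top
    (measurable_weight_mul_detPow q measurable_gaussWeight),
    lintegral_weight_mul_detPow q hN measurable_gaussWeight]
  exact ENNReal.mul_lt_top h (ENNReal.pow_lt_top
    ((lintegral_radius_lt_top_iff hN measurable_gaussWeight).2
      (mellinConvergent_gaussWeight.2 (re_finrank_add_pos hq))))

theorem exists_absDet_sphere_le (β : DysonIndex) (N : ℕ) :
    ∃ C : ℝ, ∀ s : Fin N → sphere (0 : β.Column N) 1,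
      absDet β (ofColumns fun i => (s i : β.Column N)) ≤ C := by
  have : ProperSpace (β.Column N) := FiniteDimensional.proper_real _
  have hc : Continuous fun s : Fin N → sphere (0 : β.Column N) 1 =>
      absDet β (ofColumns fun i => (s i : β.Column N)) :=
    continuous_absDet.comp
      (continuous_pi fun i => continuous_subtype_val.comp (continuous_apply i))
  obtain ⟨C, hC⟩ := isCompact_univ.exists_bound_of_continuousOn hc.continuousOn
  exact ⟨C, fun s => (le_abs_self _).trans (hC s (mem_univ s))⟩

/-- For bounded `x`, a power of larger real exponent is controlled by one of smaller real part. The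
condition `p ≠ 0` covers `x = 0`, where `0 ^ 0 = 1` could break the bound. -/
theorem norm_cpow_le_of_le {x C : ℝ} (hx : 0 ≤ x) (hC : x ≤ C) {p : ℝ} (hp : p ≠ 0)
    (hqp : q.re ≤ p) : ‖(x : ℂ) ^ (p : ℂ)‖ ≤ C ^ (p - q.re) * ‖(x : ℂ) ^ q‖ := by
  rcases hx.eq_or_lt with rfl | hx
  · rw [Complex.ofReal_zero, Complex.zero_cpow (by exact_mod_cast hp), norm_zero]
    positivity
  · rw [Complex.norm_cpow_eq_rpow_re_of_pos hx, Complex.norm_cpow_eq_rpow_re_of_pos hx,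
      Complex.ofReal_re]
    calc x ^ p = x ^ (p - q.re) * x ^ q.re := by rw [← Real.rpow_add hx]; ring_nf
      _ ≤ C ^ (p - q.re) * x ^ q.re := by
        gcongr

/-- When `Re q ≤ -βN` the radial integrals diverge and the Gaussian comparison says nothing. As
`|det|` is bounded on the sphere, convergence at `q` with `Re q ≤ -β` would give convergence at
`-β`, where the comparison does apply and refutes it. -/
theorem neg_val_lt_of_integrable_sphere (hN : 2 ≤ N)
    (h : Integrable (fun s : Fin N → sphere (0 : β.Column N) 1 =>
      detPow q fun i => (s i : β.Column N)) (Measure.pi fun _ => surfaceMeasure β N)) :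
    -(β.val : ℝ) < q.re := by
  by_contra! hq
  obtain ⟨C, hC⟩ := exists_absDet_sphere_le β N
  have hβ : (0 : ℝ) < β.val := by exact_mod_cast val_pos β
  have hN' : (2 : ℝ) ≤ N := by exact_mod_cast hN
  have h1 : Integrable (fun s : Fin N → sphere (0 : β.Column N) 1 =>
      detPow ((-(β.val : ℝ) : ℝ) : ℂ) fun i => (s i : β.Column N))
      (Measure.pi fun _ => surfaceMeasure β N) :=
    (h.norm.const_mul (C ^ (-(β.val : ℝ) - q.re))).mono'
      (measurable_detPow_sphere _).aestronglyMeasurable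
      (.of_forall fun s => norm_cpow_le_of_le (absDet_nonneg _) (hC s) (by linarith) hq)
  have h2 := neg_val_lt_of_lintegral_sphere (q := ((-(β.val : ℝ) : ℝ) : ℂ)) (by omega)
    -- Here `N ≥ 2` is essential: `-βN < -β`.
    (by rw [finrank_column, Complex.ofReal_re, Nat.cast_mul]; nlinarith)
    ((integrable_iff_lintegral_enorm_lt_top (measurable_detPow_sphere _)).1 h1)
  rw [Complex.ofReal_re] at h2
  exact lt_irrefl _ h2

/-- The moments of `|det M|` for columns on the unit sphere. -/
theorem integral_detPow_sphere (hN : 1 ≤ N) (hq : -(β.val : ℝ) < q.re) :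
    ∫ s : Fin N → sphere (0 : β.Column N) 1, detPow q (fun i => (s i : β.Column N))
        ∂(Measure.pi fun _ => surfaceMeasure β N) =
      areaProd β N q * sphereArea (Module.finrank ℝ (β.Column N) + q) ^ N := by
  have hs := re_finrank_add_pos (neg_val_mul_lt (β := β) hN hq)
  have h := integral_weight_mul_detPow (β := β) q hN measurable_gaussWeight
  rw [integral_detPow_gauss hq, radiusMeasure, integral_volumeIoiPow (finrank_column_pos hN),
    ← sphereArea_eq_pi_cpow hs, ← mellin_gaussWeight hs, mul_pow] at h
  refine mul_right_cancel₀ (pow_ne_zero N (mellin_gaussWeight_ne_zero hs)) ?_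
  rw [← h]
  ring

/-- Eliminating the only column leaves an empty minor, which treats the three number systems at
once. -/
theorem absDet_ofColumns_one (m : Fin 1 → β.Column 1) : absDet β (ofColumns m) = ‖m 0‖ := by
  obtain ⟨U, hU⟩ := exists_linearIsometryEquiv_absDet_cons (m 0)
  have h := hU Fin.elim0
  rw [absDet_ofColumns_zero, mul_one] at h
  rw [← h]
  congr 2
  ext i
  rw [Fin.fin_one_eq_zero i]
  rfl

/-- The integrand is `1`, so no condition on `q` appears. -/
theorem integral_detPow_sphere_one :
    ∫ s : Fin 1 → sphere (0 : β.Column 1) 1, detPow q (fun i => (s i : β.Column 1))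
        ∂(Measure.pi fun _ => surfaceMeasure β 1) = sphereArea β.val := by
  have := nontrivial_column (β := β) le_rfl
  have h : ∀ s : Fin 1 → sphere (0 : β.Column 1) 1,
      detPow q (fun i => (s i : β.Column 1)) = 1 := fun s => by
    rw [detPow, absDet_ofColumns_one, norm_eq_of_mem_sphere (s 0)]
    simp
  simp only [h]
  have h1 := toSphere_real_univ (β.Column 1)
  rw [finrank_column, mul_one] at h1
  rw [← h1, integral_const, Complex.real_smul, mul_one, Measure.real, Measure.pi_univ]
  simp [Measure.real, surfaceMeasure]

theorem integrable_detPow_ball (hN : 1 ≤ N) (hq : -(β.val : ℝ) < q.re) :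
    Integrable fun m : Fin N → β.Column N => (∏ i, ballWeight ‖m i‖) * detPow q m := by
  rw [integrable_iff_lintegral_enorm_lt_top
    (measurable_weight_mul_detPow q measurable_ballWeight),
    lintegral_weight_mul_detPow q hN measurable_ballWeight]
  exact ENNReal.mul_lt_top ((integrable_iff_lintegral_enorm_lt_top
      (measurable_detPow_sphere _)).1 (integrable_detPow_sphere hN hq)) (ENNReal.pow_lt_top
    ((lintegral_radius_lt_top_iff hN measurable_ballWeight).2
      (mellinConvergent_ballWeight.2 (re_finrank_add_pos (neg_val_mul_lt hN hq)))))

theorem neg_val_lt_of_integrable_ball (hN : 1 ≤ N)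
    (h : Integrable fun m : Fin N → β.Column N => (∏ i, ballWeight ‖m i‖) * detPow q m) :
    -(β.val : ℝ) < q.re := by
  rw [integrable_iff_lintegral_enorm_lt_top
    (measurable_weight_mul_detPow q measurable_ballWeight),
    lintegral_weight_mul_detPow q hN measurable_ballWeight] at h
  -- The nonzero spherical factor forces the radial one to be finite, giving `Re q > -βN`; then the
  -- radial factor is nonzero, the spherical one is finite, and the stronger bound follows.
  have h1 := ENNReal.lt_top_of_mul_ne_top_right h.ne (lintegral_sphere_ne_zero hN)
  have h2 := (ENNReal.pow_lt_top_iff.1 h1).resolve_right (by omega)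
  have h3 := mellinConvergent_ballWeight.1
    ((lintegral_radius_lt_top_iff hN measurable_ballWeight).1 h2)
  refine neg_val_lt_of_lintegral_sphere hN ?_ (ENNReal.lt_top_of_mul_ne_top_left h.ne
    (pow_ne_zero _ (lintegral_radius_ne_zero hN (mellin_ballWeight_ne_zero h3))))
  rw [Complex.add_re, Complex.natCast_re] at h3
  linarith

/-- The moments of `|det M|` for columns in the unit ball. -/
theorem integral_detPow_ball (hN : 1 ≤ N) (hq : -(β.val : ℝ) < q.re) :
    ∫ m : Fin N → β.Column N, (∏ i, ballWeight ‖m i‖) * detPow q m =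
      areaProd β N q * sphereArea (Module.finrank ℝ (β.Column N) + q) ^ N *
        (1 / (Module.finrank ℝ (β.Column N) + q)) ^ N := by
  rw [integral_weight_mul_detPow q hN measurable_ballWeight, integral_detPow_sphere hN hq,
    radiusMeasure, integral_volumeIoiPow (finrank_column_pos hN),
    mellin_ballWeight (re_finrank_add_pos (neg_val_mul_lt hN hq))]

theorem indicator_ball_detPow :
    indicator {m : Fin N → β.Column N | ∀ i, ‖m i‖ ≤ 1} (detPow q) =
      fun m => (∏ i, ballWeight ‖m i‖) * detPow q m := by
  ext m
  by_cases hm : m ∈ {m : Fin N → β.Column N | ∀ i, ‖m i‖ ≤ 1}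
  · rw [indicator_of_mem hm, Finset.prod_eq_one, one_mul]
    exact fun i _ => indicator_of_mem (mem_Iic.2 (hm i)) _
  · rw [indicator_of_notMem hm]
    obtain ⟨i, hi⟩ := not_forall.1 (show ¬∀ i, ‖m i‖ ≤ 1 from hm)
    rw [Finset.prod_eq_zero (Finset.mem_univ i) (indicator_of_notMem (mt mem_Iic.1 hi) _), zero_mul]

theorem measurableSet_ball_columns :
    MeasurableSet {m : Fin N → β.Column N | ∀ i, ‖m i‖ ≤ 1} := by
  rw [ofPred_forall]
  exact MeasurableSet.iInter fun i =>
    measurableSet_le (measurable_pi_apply i).norm measurable_const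

theorem integrableOn_ball_iff :
    IntegrableOn (detPow q) {m : Fin N → β.Column N | ∀ i, ‖m i‖ ≤ 1} ↔
      Integrable fun m : Fin N → β.Column N => (∏ i, ballWeight ‖m i‖) * detPow q m := by
  rw [← integrable_indicator_iff measurableSet_ball_columns, indicator_ball_detPow]

theorem setIntegral_ball_detPow :
    ∫ m in {m : Fin N → β.Column N | ∀ i, ‖m i‖ ≤ 1}, detPow q m =
      ∫ m : Fin N → β.Column N, (∏ i, ballWeight ‖m i‖) * detPow q m := by
  rw [← integral_indicator measurableSet_ball_columns, indicator_ball_detPow]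

theorem exp_mul_detPow (m : Fin N → β.Column N) :
    (Real.exp (-∑ l, ‖m l‖ ^ 2) : ℂ) * detPow q m = (∏ i, gaussWeight ‖m i‖) * detPow q m := by
  rw [← Finset.sum_neg_distrib, Real.exp_sum, Complex.ofReal_prod]
  rfl

/-- Reindexing by `k = N - i`, together with `βn = βN + q`. -/
theorem prod_Icc_sphereArea {b n : ℂ} (hb : b = β.val) (hn : n = N + q / b) :
    ∏ i ∈ Finset.Icc 1 N, sphereArea (b * (N - i + 1)) / sphereArea (b * (n - i + 1)) =
      areaProd β N q := by
  have hb0 : b ≠ 0 := by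
    rw [hb]
    exact_mod_cast (val_pos β).ne'
  refine Finset.prod_nbij' (fun i => N - i) (fun k => N - k) ?_ ?_ ?_ ?_ fun i hi => ?_
  · intro i hi; simp only [Finset.mem_Icc, Finset.mem_range] at *; omega
  · intro i hi; simp only [Finset.mem_Icc, Finset.mem_range] at *; omega
  · intro i hi; simp only [Finset.mem_Icc] at *; omega
  · intro i hi; simp only [Finset.mem_range] at *; omega
  · rw [Nat.cast_sub (Finset.mem_Icc.1 hi).2, ← hb,
      show b * (n - i + 1) = b * (N - i + 1) + q by rw [hn]; field_simp; ring]

end DysonIndex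

end

/-! ### The three moment formulas -/

open DysonIndex in
theorem propositionP7 (β : DysonIndex) (N : ℕ) (hN : 1 ≤ N) (q n b : ℂ)
    (hb : b = (β.val : ℂ)) (hn : n = N + q / b) :
    -- columns uniform in the unit ball
    ((-(β.val : ℝ) < q.re →
        IntegrableOn (fun m : Fin N → β.Column N =>
          ((absDet β (DysonIndex.ofColumns m) : ℝ) : ℂ) ^ q) {m | ∀ i, ‖m i‖ ≤ 1}) ∧
      (IntegrableOn (fun m : Fin N → β.Column N =>
          ((absDet β (DysonIndex.ofColumns m) : ℝ) : ℂ) ^ q) {m | ∀ i, ‖m i‖ ≤ 1} →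
        (∀ i ∈ Finset.Icc 1 N, sphereArea (b * (n - i + 1)) ≠ 0) →
        (b * N / sphereArea (b * N)) ^ N *
            ∫ m in {m : Fin N → β.Column N | ∀ i, ‖m i‖ ≤ 1},
              ((absDet β (DysonIndex.ofColumns m) : ℝ) : ℂ) ^ q =
          (∏ i ∈ Finset.Icc 1 N,
              sphereArea (b * (N - i + 1)) / sphereArea (b * (n - i + 1))) *
            (N * sphereArea (b * n) / (n * sphereArea (b * N))) ^ N)) ∧
    -- columns uniform on the unit sphere
    ((-(β.val : ℝ) < q.re →
        Integrable (fun m : Fin N → Metric.sphere (0 : β.Column N) 1 =>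
          ((absDet β (DysonIndex.ofColumns fun i => (m i : β.Column N)) : ℝ) : ℂ) ^ q)
          (Measure.pi fun _ => surfaceMeasure β N)) ∧
      (Integrable (fun m : Fin N → Metric.sphere (0 : β.Column N) 1 =>
          ((absDet β (DysonIndex.ofColumns fun i => (m i : β.Column N)) : ℝ) : ℂ) ^ q)
          (Measure.pi fun _ => surfaceMeasure β N) →
        (∀ i ∈ Finset.Icc 1 N, sphereArea (b * (n - i + 1)) ≠ 0) →
        (1 / sphereArea (b * N)) ^ N *
            ∫ m : Fin N → Metric.sphere (0 : β.Column N) 1,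
              ((absDet β (DysonIndex.ofColumns fun i => (m i : β.Column N)) : ℝ) : ℂ) ^ q
              ∂(Measure.pi fun _ => surfaceMeasure β N) =
          (∏ i ∈ Finset.Icc 1 N,
              sphereArea (b * (N - i + 1)) / sphereArea (b * (n - i + 1))) *
            (sphereArea (b * n) / sphereArea (b * N)) ^ N)) ∧
    -- Gaussian columns
    ((-(β.val : ℝ) < q.re →
        Integrable (fun m : Fin N → β.Column N =>
          (Real.exp (-∑ l, ‖m l‖ ^ 2) : ℂ) *
            ((absDet β (DysonIndex.ofColumns m) : ℝ) : ℂ) ^ q)) ∧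
      (Integrable (fun m : Fin N → β.Column N =>
          (Real.exp (-∑ l, ‖m l‖ ^ 2) : ℂ) *
            ((absDet β (DysonIndex.ofColumns m) : ℝ) : ℂ) ^ q) →
        (∀ i ∈ Finset.Icc 1 N, sphereArea (b * (n - i + 1)) ≠ 0) →
        (1 / (Real.pi : ℂ)) ^ (b * N ^ 2 / 2) *
            ∫ m : Fin N → β.Column N,
              (Real.exp (-∑ l, ‖m l‖ ^ 2) : ℂ) *
                ((absDet β (DysonIndex.ofColumns m) : ℝ) : ℂ) ^ q =
          (∏ i ∈ Finset.Icc 1 N,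
              sphereArea (b * (N - i + 1)) / sphereArea (b * (n - i + 1))) *
            (1 / (Real.pi : ℂ)) ^ (b * N * (N - n) / 2))) := by
  have hprod := prod_Icc_sphereArea hb hn
  have hb0 : b ≠ 0 := by
    rw [hb]
    exact_mod_cast (val_pos β).ne'
  have hN0 : (N : ℂ) ≠ 0 := by
    exact_mod_cast (by omega : N ≠ 0)
  have hd : (Module.finrank ℝ (β.Column N) : ℂ) = b * N := by
    rw [finrank_column, hb, Nat.cast_mul]
  have hbn : b * N + q = b * n := by
    rw [hn]
    field_simp
  have hgauss : (fun m : Fin N → β.Column N => (Real.exp (-∑ l, ‖m l‖ ^ 2) : ℂ) *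
      ((absDet β (ofColumns m) : ℝ) : ℂ) ^ q) =
      fun m => (∏ i, gaussWeight ‖m i‖) * detPow q m := funext exp_mul_detPow
  rw [hprod, hgauss]
  have hσ : sphereArea (b * N) ≠ 0 := by
    refine sphereArea_ne_zero ?_
    rw [← hd, Complex.natCast_re]
    exact_mod_cast finrank_column_pos hN
  refine ⟨⟨fun hq => integrableOn_ball_iff.2 (integrable_detPow_ball hN hq), fun hint _ => ?_⟩,
    ⟨fun hq => integrable_detPow_sphere hN hq, fun hint hne => ?_⟩,
    ⟨fun hq => (integrable_detPow_gauss_iff hN).2 hq, fun hint _ => ?_⟩⟩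
  · have hq := neg_val_lt_of_integrable_ball hN (integrableOn_ball_iff.1 hint)
    have hs := re_finrank_add_pos (neg_val_mul_lt (β := β) hN hq)
    have h := (setIntegral_ball_detPow (β := β) (N := N) (q := q)).trans
      (integral_detPow_ball hN hq)
    rw [hd, hbn] at h hs
    have hn0 : n ≠ 0 := by
      rintro rfl
      simp at hs
    refine (congrArg (fun z => (b * N / sphereArea (b * N)) ^ N * z) h).trans ?_
    rw [mul_left_comm, mul_assoc (areaProd β N q), ← mul_pow, ← mul_pow]
    congr 2
    field_simp
  · rcases lt_or_ge 1 N with hN2 | hN1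
    · have hq := neg_val_lt_of_integrable_sphere hN2 hint
      have h := integral_detPow_sphere hN hq
      rw [hd, hbn] at h
      refine (congrArg (fun z => (1 / sphereArea (b * N)) ^ N * z) h).trans ?_
      rw [mul_left_comm, ← mul_pow]
      congr 2
      field_simp
    -- For `N = 1` convergence does not restrict `q`; the assumed nonvanishing of `sphereArea (b *
    -- n)` is what allows it to cancel on the right.
    · obtain rfl : N = 1 := le_antisymm hN1 hN
      have h := integral_detPow_sphere_one (β := β) (q := q)
      have h1 := hne 1 (by simp)
      refine (congrArg (fun z => (1 / sphereArea (b * (1 : ℕ))) ^ 1 * z) h).trans ?_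
      rw [← hprod, ← hb]
      simp only [Nat.cast_one, sub_add_cancel, mul_one] at h1 hσ
      simp only [Finset.Icc_self, Finset.prod_singleton, Nat.cast_one, sub_add_cancel, mul_one,
        pow_one]
      field_simp
  · have hq := (integrable_detPow_gauss_iff hN).1 hint
    have h := integral_detPow_gauss (β := β) (N := N) hq
    rw [hd, hbn] at h
    rw [h, ← mul_assoc, mul_comm (areaProd β N q)]
    congr 1
    -- Inversion commutes with the complex power because `arg π = 0` is off the branch cut; what
    -- remains is an identity of exponents of `π`.
    rw [← Complex.cpow_nat_mul, one_div, Complex.inv_cpow _ _ (by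
        rw [Complex.arg_ofReal_of_nonneg Real.pi_pos.le]; exact Real.pi_ne_zero.symm),
      Complex.inv_cpow _ _ (by
        rw [Complex.arg_ofReal_of_nonneg Real.pi_pos.le]; exact Real.pi_ne_zero.symm),
      ← Complex.cpow_neg, ← Complex.cpow_neg, ← Complex.cpow_add _ _ (by
        exact_mod_cast Real.pi_ne_zero)]
    congr 1
    ring
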